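/- Let $\ell,h>0$ and $V^->V^+>0$, and let $V(x)=V^-$ for $x<0$ and $V(x)=V^+$ for $x\ge 0$. Let $w:\mathbb R\to[0,\infty)$ vanish outside $[0,h]$, be Lipschitz continuous on $[0,h]$, and satisfy $\int_0^h w(x)\,dx=1$, $w(h)=0$ and $w'(x)<0$ for all $x\in[0,h]$ (one-sided derivatives at the end points). Let $\phi:[0,1]\to[0,1]$ be a $C^2$ function with $\phi(0)=1$, $\phi(1)=0$, and $\phi'<0$, $\phi''\le 0$ on $[0,1]$. Put $f(\rho)=\rho\,\phi(\rho)$, and let $\hat\rho\in[0,1]$ be the unique point with $f'(\hat\rho)=0$. For $P:\mathbb R\to(0,1)$ put $L^P(x)=x+\ell/P(x)$, and for $x\in\mathbb R$ let $P^\ell_{\{x\}}$ be the piecewise constant function on $[x,\infty)$ given by $$P^\ell_{\{x\}}(y)=P\big((L^P)^k(x)\big)\quad\text{for } y\in\big[(L^P)^k(x),(L^P)^{k+1}(x)\big),\quad k=0,1,2,\dots,$$ where $(L^P)^k$ is the $k$-fold composition of $L^P$. For $z\ge x$ put $$v^*(z;P^\ell_{\{x\}})=\int_z^{z+h}V(y)\,\phi\big(P^\ell_{\{x\}}(y)\big)\,w(y-z)\,dy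 .$$ Given $\rho^-,\rho^+$, a *profile* is a $C^1$ function $P:\mathbb R\to(0,1)$ that satisfies, for all $x\in\mathbb R$, the delay integro-differential equation $$P'(x)=\frac{P(x)^2}{\ell\, v^*(x;P^\ell_{\{x\}})}\Big[v^*(x;P^\ell_{\{x\}})-v^*(L^P(x);P^\ell_{\{x\}})\Big]$$ together with $$\lim_{x\to-\infty}P(x)=\rho^-,\qquad \lim_{x\to+\infty}P(x)=\rho^+ .$$ **Theorem.** Suppose that $0<\rho^-<\rho^+\le\hat\rho$ and $V^-f(\rho^-)=V^+f(\rho^+)$. Then there is exactly one monotone profile $P$. It is nondecreasing, and $P(x)=\rho^+$ for all $x\ge 0$. -/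

import Mathlib

open Set Filter Topology

namespace FollowTheLeaders

noncomputable section

/-- The rough road condition: speed limit `Vm` on `x < 0` and `Vp` on `x ≥ 0`. -/
def speedLimit (Vm Vp : ℝ) (x : ℝ) : ℝ := if x < 0 then Vm else Vp

/-- Admissible weight functions: supported on `[0, h]`, Lipschitz there (hence bounded),
nonnegative, of integral one, with `w(h) = 0` and `w' < 0` on `[0, h]` (one-sided derivatives
at the end points; a negative value of `derivWithin` forces differentiability). -/
structure IsWeight (h : ℝ) (w : ℝ → ℝ) : Prop where
  eq_zero_of_notMem : ∀ x, x ∉ Icc 0 h → w x = 0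
  nonneg : ∀ x, 0 ≤ w x
  lipschitz : ∃ K : NNReal, LipschitzOnWith K w (Icc 0 h)
  integral_eq_one : ∫ x in (0 : ℝ)..h, w x = 1
  apply_end : w h = 0
  deriv_neg : ∀ x ∈ Icc 0 h, derivWithin w (Icc 0 h) x < 0

/-- Admissible velocity functions: `φ : [0,1] → [0,1]` is `C²`, `φ(0) = 1`, `φ(1) = 0`, `φ' < 0`
and `φ'' ≤ 0` on `[0,1]`. The values of `φ` outside `[0,1]` are irrelevant. -/
structure IsVelocity (φ : ℝ → ℝ) : Prop where
  mapsTo : MapsTo φ (Icc 0 1) (Icc 0 1)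
  contDiffOn : ContDiffOn ℝ 2 φ (Icc 0 1)
  apply_zero : φ 0 = 1
  apply_one : φ 1 = 0
  deriv_neg : ∀ ρ ∈ Icc (0 : ℝ) 1, derivWithin φ (Icc 0 1) ρ < 0
  deriv2_nonpos : ∀ ρ ∈ Icc (0 : ℝ) 1, iteratedDerivWithin 2 φ (Icc 0 1) ρ ≤ 0

/-- The flux function `f(ρ) = ρ φ(ρ)`. -/
def flux (φ : ℝ → ℝ) (ρ : ℝ) : ℝ := ρ * φ ρ

/-- `ρhat ∈ [0,1]` is the (unique) stationary point of the flux function. -/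
def IsStagnation (φ : ℝ → ℝ) (ρhat : ℝ) : Prop :=
  ρhat ∈ Icc (0 : ℝ) 1 ∧ derivWithin (flux φ) (Icc 0 1) ρhat = 0

/-- `L^P(x) = x + ℓ / P(x)`, the position of the leader of the car at `x`. -/
def leader (ℓ : ℝ) (P : ℝ → ℝ) (x : ℝ) : ℝ := x + ℓ / P x

/-- The piecewise constant density `P^ℓ_{x}` generated by the profile `P` and the car at `x`:
its value is `P((L^P)^k(x))` on `[(L^P)^k(x), (L^P)^{k+1}(x))`, for `k = 0, 1, 2, …`. When `P > 0`
these intervals are disjoint, so at most one term of the sum is nonzero. Only the cars at and ahead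
of `x` are recorded, since the dynamics of the car at `x` and of its leader only look ahead; the
function is set to `0` to the left of `x`, where it is never used. -/
def stepDensity (ℓ : ℝ) (P : ℝ → ℝ) (x : ℝ) (y : ℝ) : ℝ :=
  ∑' k : ℕ, (Ico ((leader ℓ P)^[k] x) ((leader ℓ P)^[k + 1] x)).indicator
    (fun _ => P ((leader ℓ P)^[k] x)) y

/-- The averaged velocity `v*(x; ρ) = ∫_x^{x+h} V(y) φ(ρ(y)) w(y - x) dy`. -/
def avgVelocity (h Vm Vp : ℝ) (φ w ρ : ℝ → ℝ) (x : ℝ) : ℝ :=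
  ∫ y in x..(x + h), speedLimit Vm Vp y * φ (ρ y) * w (y - x)

/-- The right-hand side of the delay integro-differential equation for the profile:
`P(x)² / (ℓ v*(x; P^ℓ_{x})) * [v*(x; P^ℓ_{x}) - v*(L^P(x); P^ℓ_{x})]`. -/
def profileRHS (ℓ h Vm Vp : ℝ) (φ w P : ℝ → ℝ) (x : ℝ) : ℝ :=
  P x ^ 2 / (ℓ * avgVelocity h Vm Vp φ w (stepDensity ℓ P x) x) *
    (avgVelocity h Vm Vp φ w (stepDensity ℓ P x) x -
      avgVelocity h Vm Vp φ w (stepDensity ℓ P x) (leader ℓ P x))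

/-- `P` solves the asymptotic value problem: it is a `C¹` function with values in `(0,1)` that
satisfies the delay integro-differential equation on the whole line and has the limits `ρm` at
`-∞` and `ρp` at `+∞`. -/
structure IsProfile (ℓ h Vm Vp : ℝ) (φ w : ℝ → ℝ) (ρm ρp : ℝ) (P : ℝ → ℝ) : Prop where
  contDiff : ContDiff ℝ 1 P
  mem_Ioo : ∀ x, P x ∈ Ioo (0 : ℝ) 1
  equation : ∀ x, HasDerivAt P (profileRHS ℓ h Vm Vp φ w P x) x
  tendsto_atBot : Tendsto P atBot (𝓝 ρm)
  tendsto_atTop : Tendsto P atTop (𝓝 ρp)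

end

end FollowTheLeaders

/-!
A profile is described by the motion of a car along it. If `A(x)` is the velocity of the car at `x`,
the profile equation reads `L'(x) = A(L(x)) / A(x)` for the leader map `L`
(`IsProfile.hasDerivAt_leader`), so the time `T = ∫ 1/A` from `x` to `L(x)` is the same for all `x`.
Hence all cars follow one path `z` at time intervals `T`, where `z(t + T) = L(z(t))` and
`P(z(t)) = ℓ / (z(t + T) - z(t))`, and `z'(t)` is a function of `z(t), z(t + T), z(t + 2T), …`: the
state-dependent delay has become a constant advance.

*Uniqueness* (`IsProfile.exists_isAdvanceSolution`). Let `Q` be a monotone profile, so `Q ≤ ρ⁺`. For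
`x ≥ 0` the velocity on `[x, L(x)]` is at most `V⁺ φ(Q(x))`, hence `ℓ ≤ T V⁺ f(Q(x))`. On the other
hand all velocities are at least `V⁺ φ(ρ⁺)`, and letting `x → ∞` gives `T V⁺ f(ρ⁺) ≤ ℓ`. As `f`
increases on `[0, ρ̂]`, this forces `Q = ρ⁺` on `[0, ∞)` and `T = ℓ / (V⁺ f(ρ⁺))`. The path is then
known for `t ≥ 0`, and for `t ≤ 0` it solves an equation with constant advances, whose solution is
unique because the integral operator is a contraction for an exponentially weighted norm
(`existsUnique_isAdvanceSolution`).

*Existence.* The same lemma solves the equation after a modification that keeps the gap of a car at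
least as large as the next one. Cars in a row with nonincreasing gaps see no lower speed limits and
no higher densities than their leaders, so they are at least as fast as these
(`IsModel.avgVelocity_tail_le`). By induction over steps of length `T` backwards in time, the gaps of
the solution do not increase in time, and the modification is never active
(`IsModel.isPath_of_isAdvanceSolution`). The path traces out a monotone profile. Its limit `p` at
`-∞` satisfies `T V⁻ f(p) = ℓ`, because the gap `ℓ / P` is `T` times a velocity close to `V⁻ φ(p)`;
hence `f(p) = f(ρ⁻)` and `p = ρ⁻` (`IsModel.tendsto_pathProfile_atBot`).
-/

namespace FollowTheLeaders

variable {φ w : ℝ → ℝ} {h : ℝ}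

/-! ### Velocity and flux -/

lemma IsVelocity.strictAntiOn (hφ : IsVelocity φ) : StrictAntiOn φ (Icc 0 1) := by
  refine strictAntiOn_of_deriv_neg (convex_Icc 0 1) hφ.contDiffOn.continuousOn fun x hx => ?_
  rw [interior_Icc] at hx
  rw [← derivWithin_of_mem_nhds (Icc_mem_nhds hx.1 hx.2)]
  exact hφ.deriv_neg x (Ioo_subset_Icc_self hx)

lemma IsVelocity.antitoneOn_derivWithin (hφ : IsVelocity φ) :
    AntitoneOn (derivWithin φ (Icc 0 1)) (Icc 0 1) := by
  have hC : ContDiffOn ℝ 1 (derivWithin φ (Icc 0 1)) (Icc 0 1) :=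
    hφ.contDiffOn.derivWithin (uniqueDiffOn_Icc one_pos) (by norm_num)
  refine antitoneOn_of_deriv_nonpos (convex_Icc 0 1) hC.continuousOn
    ((hC.differentiableOn (by norm_num)).mono interior_subset) fun x hx => ?_
  rw [interior_Icc] at hx
  rw [← derivWithin_of_mem_nhds (Icc_mem_nhds hx.1 hx.2)]
  have h2 := hφ.deriv2_nonpos x (Ioo_subset_Icc_self hx)
  rwa [iteratedDerivWithin_succ, iteratedDerivWithin_one] at h2

lemma IsVelocity.pos (hφ : IsVelocity φ) {ρ : ℝ} (h0 : 0 ≤ ρ) (h1 : ρ < 1) : 0 < φ ρ := by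
  have := hφ.strictAntiOn ⟨h0, h1.le⟩ ⟨zero_le_one, le_rfl⟩ h1
  rwa [hφ.apply_one] at this

lemma IsVelocity.exists_lipschitzOnWith (hφ : IsVelocity φ) :
    ∃ K, LipschitzOnWith K φ (Icc 0 1) :=
  hφ.contDiffOn.exists_lipschitzOnWith (by norm_num) (convex_Icc 0 1) isCompact_Icc

lemma IsVelocity.derivWithin_flux (hφ : IsVelocity φ) {ρ : ℝ} (hρ : ρ ∈ Icc (0 : ℝ) 1) :
    derivWithin (flux φ) (Icc 0 1) ρ = φ ρ + ρ * derivWithin φ (Icc 0 1) ρ := by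
  have hd : DifferentiableWithinAt ℝ φ (Icc 0 1) ρ :=
    hφ.contDiffOn.differentiableOn (by norm_num) ρ hρ
  have h1 : HasDerivWithinAt (flux φ) (1 * φ ρ + ρ * derivWithin φ (Icc 0 1) ρ) (Icc 0 1) ρ :=
    (hasDerivWithinAt_id ρ (Icc (0 : ℝ) 1)).mul hd.hasDerivWithinAt
  rw [h1.derivWithin (uniqueDiffOn_Icc one_pos ρ hρ), one_mul]

lemma IsVelocity.strictAntiOn_derivWithin_flux (hφ : IsVelocity φ) :
    StrictAntiOn (derivWithin (flux φ) (Icc 0 1)) (Icc 0 1) := by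
  intro x hx y hy hxy
  rw [hφ.derivWithin_flux hx, hφ.derivWithin_flux hy]
  have h1 := hφ.strictAntiOn hx hy hxy
  have h2 := hφ.antitoneOn_derivWithin hx hy hxy.le
  have h3 := hφ.deriv_neg y hy
  nlinarith [hx.1]

lemma IsStagnation.lt_one (hφ : IsVelocity φ) {r : ℝ} (hr : IsStagnation φ r) : r < 1 := by
  refine lt_of_le_of_ne hr.1.2 ?_
  rintro rfl
  have h1 := hr.2
  rw [hφ.derivWithin_flux hr.1, hφ.apply_one] at h1
  have := hφ.deriv_neg 1 hr.1
  linarith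

lemma IsVelocity.continuousOn_flux (hφ : IsVelocity φ) : ContinuousOn (flux φ) (Icc 0 1) :=
  continuousOn_id.mul hφ.contDiffOn.continuousOn

lemma IsStagnation.strictMonoOn_flux (hφ : IsVelocity φ) {r : ℝ} (hr : IsStagnation φ r) :
    StrictMonoOn (flux φ) (Icc 0 r) := by
  refine strictMonoOn_of_deriv_pos (convex_Icc 0 r)
    (hφ.continuousOn_flux.mono (Icc_subset_Icc_right hr.1.2)) fun x hx => ?_
  rw [interior_Icc] at hx
  rw [← derivWithin_of_mem_nhds (Icc_mem_nhds hx.1 (hx.2.trans_le hr.1.2))]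
  refine hr.2.symm.trans_lt ?_
  exact hφ.strictAntiOn_derivWithin_flux ⟨hx.1.le, hx.2.le.trans hr.1.2⟩ hr.1 hx.2

/-! ### Weights -/

lemma IsWeight.continuousOn_Ici (hw : IsWeight h w) (hh : 0 < h) : ContinuousOn w (Ici 0) := by
  obtain ⟨K, hK⟩ := hw.lipschitz
  have h2 : ContinuousOn w (Ici h) := by
    refine (continuousOn_const (c := (0 : ℝ))).congr fun x hx => ?_
    rcases eq_or_lt_of_le (mem_Ici.1 hx) with rfl | hlt
    · exact hw.apply_end
    · exact hw.eq_zero_of_notMem x fun hm => not_lt.2 hm.2 hlt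
  have := hK.continuousOn.union_of_isClosed h2 isClosed_Icc isClosed_Ici
  rwa [Icc_union_Ici_eq_Ici hh.le] at this

lemma IsWeight.intervalIntegrable (hw : IsWeight h w) (hh : 0 < h) (a b : ℝ) :
    IntervalIntegrable w MeasureTheory.volume a b := by
  have key : ∀ c, IntervalIntegrable w MeasureTheory.volume 0 c := by
    intro c
    rcases le_total 0 c with hc | hc
    · refine ContinuousOn.intervalIntegrable ?_
      rw [uIcc_of_le hc]
      exact (hw.continuousOn_Ici hh).mono Icc_subset_Ici_self
    · refine IntervalIntegrable.symm ?_
      refine (intervalIntegrable_const (c := (0 : ℝ))).congr_uIoo ?_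
      intro x hx
      rw [uIoo_of_le hc] at hx
      exact (hw.eq_zero_of_notMem x fun hm => not_lt.2 hm.1 hx.2).symm
  exact (key a).symm.trans (key b)

lemma IsWeight.exists_bound (hw : IsWeight h w) : ∃ M, 0 ≤ M ∧ ∀ x, w x ≤ M := by
  obtain ⟨K, hK⟩ := hw.lipschitz
  obtain ⟨M, hM⟩ := isCompact_Icc.exists_bound_of_continuousOn hK.continuousOn
  refine ⟨max M 0, le_max_right _ _, fun x => ?_⟩
  by_cases hx : x ∈ Icc 0 h
  · exact (le_abs_self _).trans ((hM x hx).trans (le_max_left _ _))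
  · rw [hw.eq_zero_of_notMem x hx]
    exact le_max_right _ _

/-- The cumulative weight `s ↦ ∫₀ˢ w`. -/
noncomputable def cumWeight (w : ℝ → ℝ) (s : ℝ) : ℝ := ∫ x in (0 : ℝ)..s, w x

lemma IsWeight.exists_lipschitz_cumWeight (hw : IsWeight h w) (hh : 0 < h) :
    ∃ M, 0 ≤ M ∧ ∀ s t, |cumWeight w s - cumWeight w t| ≤ M * |s - t| := by
  obtain ⟨M, hM0, hM⟩ := hw.exists_bound
  refine ⟨M, hM0, fun s t => ?_⟩
  unfold cumWeight
  rw [intervalIntegral.integral_interval_sub_left (hw.intervalIntegrable hh _ _)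
    (hw.intervalIntegrable hh _ _), ← Real.norm_eq_abs]
  refine intervalIntegral.norm_integral_le_of_norm_le_const fun x _ => ?_
  rw [Real.norm_eq_abs, abs_of_nonneg (hw.nonneg x)]
  exact hM x

lemma IsWeight.intervalIntegrable_mul (hw : IsWeight h w) (hh : 0 < h) {m : ℝ → ℝ} {x p q : ℝ}
    (hm : AntitoneOn m (Ici x)) (hp : x ≤ p) (hq : x ≤ q) :
    IntervalIntegrable (fun y => m y * w (y - x)) MeasureTheory.volume p q := by
  have hsub : uIcc p q ⊆ Ici x := fun y hy => (le_min hp hq).trans hy.1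
  refine (AntitoneOn.intervalIntegrable (hm.mono hsub)).mul_continuousOn ?_
  exact (hw.continuousOn_Ici hh).comp (by fun_prop) fun y hy => by
    simpa using hsub hy

lemma IsWeight.integral_window (hw : IsWeight h w) (x : ℝ) :
    ∫ y in x..(x + h), w (y - x) = 1 := by
  rw [intervalIntegral.integral_comp_sub_right]
  simpa using hw.integral_eq_one

lemma IsWeight.intervalIntegrable_shift (hw : IsWeight h w) (hh : 0 < h) (x p q : ℝ) :
    IntervalIntegrable (fun y => w (y - x)) MeasureTheory.volume p q := by
  have := (hw.intervalIntegrable hh (p - x) (q - x)).comp_sub_right x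
  simpa using this

lemma IsWeight.average_le (hw : IsWeight h w) (hh : 0 < h) {m : ℝ → ℝ} {x C : ℝ}
    (hm : AntitoneOn m (Ici x)) (hC : ∀ y ∈ Icc x (x + h), m y ≤ C) :
    ∫ y in x..(x + h), m y * w (y - x) ≤ C := by
  have h1 : ∫ y in x..(x + h), m y * w (y - x) ≤ ∫ y in x..(x + h), C * w (y - x) :=
    intervalIntegral.integral_mono_on (by linarith)
      (hw.intervalIntegrable_mul hh hm le_rfl (by linarith))
      ((hw.intervalIntegrable_shift hh x _ _).const_mul C)
      fun y hy => mul_le_mul_of_nonneg_right (hC y hy) (hw.nonneg _)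
  rwa [intervalIntegral.integral_const_mul, hw.integral_window, mul_one] at h1

lemma IsWeight.le_average (hw : IsWeight h w) (hh : 0 < h) {m : ℝ → ℝ} {x C : ℝ}
    (hm : AntitoneOn m (Ici x)) (hC : ∀ y ∈ Icc x (x + h), C ≤ m y) :
    C ≤ ∫ y in x..(x + h), m y * w (y - x) := by
  have h1 : ∫ y in x..(x + h), C * w (y - x) ≤ ∫ y in x..(x + h), m y * w (y - x) :=
    intervalIntegral.integral_mono_on (by linarith)
      ((hw.intervalIntegrable_shift hh x _ _).const_mul C)
      (hw.intervalIntegrable_mul hh hm le_rfl (by linarith))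
      fun y hy => mul_le_mul_of_nonneg_right (hC y hy) (hw.nonneg _)
  rwa [intervalIntegral.integral_const_mul, hw.integral_window, mul_one] at h1

/-- The weighted average of a nonincreasing function over a look-ahead window decreases when the
window moves forward. -/
lemma IsWeight.average_anti (hw : IsWeight h w) (hh : 0 < h) {m : ℝ → ℝ} {x x' : ℝ}
    (hm : AntitoneOn m (Ici x)) (hx : x ≤ x') :
    ∫ y in x'..(x' + h), m y * w (y - x') ≤ ∫ y in x..(x + h), m y * w (y - x) := by
  have hshift : ∀ c, ∫ y in c..(c + h), m y * w (y - c) = ∫ s in (0 : ℝ)..h, m (s + c) * w s := by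
    intro c
    have := intervalIntegral.integral_comp_add_right (a := 0) (b := h)
      (fun y => m y * w (y - c)) c
    simp only [add_sub_cancel_right, zero_add] at this
    rw [this, add_comm h c]
  have hint : ∀ c, x ≤ c →
      IntervalIntegrable (fun s => m (s + c) * w s) MeasureTheory.volume 0 h := by
    intro c hc
    have hmc : AntitoneOn (fun s => m (s + c)) (Ici 0) := fun s hs t ht hst =>
      hm (by simp at hs ⊢; linarith) (by simp at ht ⊢; linarith) (by linarith)
    simpa using hw.intervalIntegrable_mul hh hmc (le_refl (0 : ℝ)) hh.le
  rw [hshift, hshift]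
  refine intervalIntegral.integral_mono_on hh.le (hint _ hx) (hint _ le_rfl) fun s hs => ?_
  exact mul_le_mul_of_nonneg_right (hm (by simp; linarith [hs.1]) (by simp; linarith [hs.1])
    (by linarith)) (hw.nonneg _)

end FollowTheLeaders

namespace FollowTheLeaders

/-! ### Differential equations with constant advances -/

/-- `F` is Lipschitz continuous, with constant `K`, for the uniform distance of sequences. -/
def SupLipschitz (K : ℝ) (F : (ℕ → ℝ) → ℝ) : Prop :=
  ∀ a b : ℕ → ℝ, ∀ δ : ℝ, (∀ k, |a k - b k| ≤ δ) → |F a - F b| ≤ K * δ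

/-- `z` solves `z'(t) = H(z(t), z(t + T), z(t + 2T), …)` for `t ≤ 0`, in integrated form, with the
data `z(t) = v t` for `t ≥ 0`. -/
structure IsAdvanceSolution (H : (ℕ → ℝ) → ℝ) (T v : ℝ) (z : ℝ → ℝ) : Prop where
  continuous : Continuous z
  eq_of_nonneg : ∀ t, 0 ≤ t → z t = v * t
  eq_integral : ∀ t ≤ 0, z t = ∫ s in (0 : ℝ)..t, H fun k => z (s + k * T)

open BoundedContinuousFunction in
/-- Existence and uniqueness, without any smallness assumption: the integral operator is a
contraction for the norm `sup |e^{λ min(t, 0)} u(t)|` if `λ` exceeds the Lipschitz constant,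
because the equation only looks ahead, where the weight is larger. -/
lemma existsUnique_isAdvanceSolution {H : (ℕ → ℝ) → ℝ} {K M : ℝ} (hc : Continuous H)
    (hM : ∀ a, |H a| ≤ M) (hK0 : 0 ≤ K) (hK : SupLipschitz K H) {T : ℝ} (hT : 0 ≤ T) (v : ℝ) :
    ∃! z : ℝ → ℝ, IsAdvanceSolution H T v z := by
  obtain ⟨l, hl⟩ : ∃ l : ℝ, l = 2 * (K + 1) := ⟨_, rfl⟩
  have hl0 : 0 < l := by linarith
  have hM0 : 0 ≤ M := (abs_nonneg _).trans (hM fun _ => 0)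
  -- A function `u` encodes the trajectory `Z u t = v t + exp (- l min(t, 0)) u t`.
  let Z : (ℝ → ℝ) → ℝ → ℝ := fun u t => v * t + Real.exp (-(l * min t 0)) * u t
  let R : (ℝ → ℝ) → ℝ → ℝ := fun z s => H fun k => z (s + k * T)
  have hR : ∀ z, Continuous z → Continuous (R z) := fun z hz =>
    hc.comp (continuous_pi fun k => hz.comp (by fun_prop))
  have hZ : ∀ u, Continuous u → Continuous (Z u) := fun u hu => by
    simp only [Z]; fun_prop
  let Ψ : (ℝ → ℝ) → ℝ → ℝ := fun z t =>
    Real.exp (l * min t 0) * (∫ s in (0 : ℝ)..(min t 0), (R z s - v))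
  have hΨc : ∀ z, Continuous z → Continuous (Ψ z) := fun z hz => by
    have h1 : Continuous fun t => ∫ s in (0 : ℝ)..t, (R z s - v) :=
      intervalIntegral.continuous_primitive
        (fun a b => ((hR z hz).sub continuous_const).intervalIntegrable a b) 0
    have h2 : Continuous fun t : ℝ => min t 0 := by fun_prop
    exact (Real.continuous_exp.comp (continuous_const.mul h2)).mul (h1.comp h2)
  have hexp : ∀ r : ℝ, r ≤ 0 → Real.exp (l * r) * |r| ≤ 1 / l := by
    intro r hr
    have h1 : -(l * r) + 1 ≤ Real.exp (-(l * r)) := Real.add_one_le_exp _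
    have h2 : Real.exp (l * r) * Real.exp (-(l * r)) = 1 := by
      rw [← Real.exp_add]; simp
    rw [abs_of_nonpos hr, le_div_iff₀ hl0]
    nlinarith [Real.exp_pos (l * r)]
  have hΨb : ∀ z t, |Ψ z t| ≤ (M + |v|) * (1 / l) := by
    intro z t
    have h1 : ‖∫ s in (0 : ℝ)..(min t 0), (R z s - v)‖ ≤ (M + |v|) * |min t 0 - 0| := by
      refine intervalIntegral.norm_integral_le_of_norm_le_const fun s _ => ?_
      exact (norm_sub_le _ _).trans (add_le_add (hM _) le_rfl)
    rw [sub_zero, Real.norm_eq_abs] at h1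
    simp only [Ψ]
    rw [abs_mul, abs_of_pos (Real.exp_pos _)]
    calc _ ≤ Real.exp (l * min t 0) * ((M + |v|) * |min t 0|) := by gcongr
      _ = (M + |v|) * (Real.exp (l * min t 0) * |min t 0|) := by ring
      _ ≤ _ := by
        have := hexp (min t 0) (min_le_right _ _)
        gcongr
  let Φ : (ℝ →ᵇ ℝ) → (ℝ →ᵇ ℝ) := fun u =>
    BoundedContinuousFunction.ofNormedAddCommGroup (Ψ (Z u)) (hΨc _ (hZ _ u.continuous))
      ((M + |v|) * (1 / l)) (hΨb _)
  have hΦ : ContractingWith (1 / 2) Φ := by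
    refine ⟨by norm_num, LipschitzWith.of_dist_le_mul fun u u' => ?_⟩
    have hd0 : 0 ≤ dist u u' := dist_nonneg
    refine (BoundedContinuousFunction.dist_le (by positivity)).2 fun t => ?_
    have hRd : ∀ s, s ≤ 0 →
        ‖R (Z u) s - R (Z u') s‖ ≤ K * dist u u' * Real.exp (-(l * s)) := by
      intro s hs
      rw [mul_assoc]
      refine hK _ _ _ fun k => ?_
      have h1 : Z u (s + k * T) - Z u' (s + k * T)
          = Real.exp (-(l * min (s + k * T) 0)) * (u (s + k * T) - u' (s + k * T)) := by
        simp only [Z]; ring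
      rw [h1, abs_mul, abs_of_pos (Real.exp_pos _), mul_comm]
      have h2 : |u (s + k * T) - u' (s + k * T)| ≤ dist u u' :=
        BoundedContinuousFunction.dist_coe_le_dist (f := u) (g := u') _
      have h3 : s ≤ min (s + k * T) 0 := le_min (by nlinarith [Nat.cast_nonneg (α := ℝ) k]) hs
      gcongr
    set r := min t 0 with hr
    have hr0 : r ≤ 0 := min_le_right _ _
    have hprim : ∫ s in r..0, K * dist u u' * Real.exp (-(l * s))
        = K * dist u u' * ((Real.exp (-(l * r)) - 1) / l) := by
      have hder : ∀ s : ℝ, HasDerivAt (fun s => -Real.exp (-(l * s)) / l)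
          (Real.exp (-(l * s))) s := by
        intro s
        have h1 : HasDerivAt (fun s : ℝ => -(l * s)) (-l) s := by
          simpa using ((hasDerivAt_id s).const_mul l).fun_neg
        refine ((h1.exp.fun_neg).div_const l).congr_deriv ?_
        field_simp
      rw [intervalIntegral.integral_const_mul,
        intervalIntegral.integral_eq_sub_of_hasDerivAt (fun s _ => hder s)
          (Continuous.intervalIntegrable (by fun_prop) _ _)]
      simp only [mul_zero, neg_zero, Real.exp_zero]
      ring
    have hint : ‖∫ s in (0 : ℝ)..r, (R (Z u) s - R (Z u') s)‖
        ≤ K * dist u u' * ((Real.exp (-(l * r)) - 1) / l) := by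
      rw [intervalIntegral.integral_symm, norm_neg, ← hprim]
      refine intervalIntegral.norm_integral_le_of_norm_le hr0 ?_
        (Continuous.intervalIntegrable (by fun_prop) _ _)
      exact Eventually.of_forall fun s hs => hRd s hs.2
    have hdiff : Φ u t - Φ u' t
        = Real.exp (l * r) * ∫ s in (0 : ℝ)..r, (R (Z u) s - R (Z u') s) := by
      change Ψ (Z u) t - Ψ (Z u') t = _
      simp only [Ψ]
      rw [← hr, ← mul_sub, ← intervalIntegral.integral_sub]
      · simp
      · exact ((hR _ (hZ _ u.continuous)).sub continuous_const).intervalIntegrable _ _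
      · exact ((hR _ (hZ _ u'.continuous)).sub continuous_const).intervalIntegrable _ _
    rw [Real.dist_eq, hdiff, abs_mul, abs_of_pos (Real.exp_pos _)]
    rw [Real.norm_eq_abs] at hint
    have h2 : Real.exp (l * r) * Real.exp (-(l * r)) = 1 := by
      rw [← Real.exp_add]; simp
    calc _ ≤ Real.exp (l * r) * (K * dist u u' * ((Real.exp (-(l * r)) - 1) / l)) := by gcongr
      _ = K * dist u u' * ((Real.exp (l * r) * Real.exp (-(l * r)) - Real.exp (l * r)) / l) := by
        ring
      _ ≤ K * dist u u' * (1 / l) := by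
        rw [h2]; gcongr; linarith [Real.exp_pos (l * r)]
      _ ≤ _ := by
        have : K * (1 / l) ≤ 1 / 2 := by
          rw [mul_one_div, div_le_div_iff₀ hl0 two_pos]; linarith
        push_cast
        nlinarith
  -- Fixed points of `Φ` and solutions of the equation correspond to each other.
  have hint_eq : ∀ z, Continuous z → ∀ t,
      ∫ s in (0 : ℝ)..t, (R z s - v) = (∫ s in (0 : ℝ)..t, R z s) - v * t := by
    intro z hz t
    rw [intervalIntegral.integral_sub ((hR z hz).intervalIntegrable _ _)
      intervalIntegrable_const]
    simp; ring
  have hsol : ∀ u, Φ u = u → IsAdvanceSolution H T v (Z u) := by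
    intro u hu
    have hu' : ∀ t, Ψ (Z u) t = u t := fun t => DFunLike.congr_fun hu t
    refine ⟨hZ _ u.continuous, fun t ht => ?_, fun t ht => ?_⟩
    · have : u t = 0 := by rw [← hu' t]; simp [Ψ, min_eq_right ht]
      simp [Z, this]
    · change _ = ∫ s in (0 : ℝ)..t, R (Z u) s
      have h1 := hu' t
      simp only [Ψ] at h1
      rw [min_eq_left ht, hint_eq _ (hZ _ u.continuous)] at h1
      have h2 : Z u t = v * t + Real.exp (-(l * t)) * u t := by simp [Z, min_eq_left ht]
      rw [h2, ← h1, ← mul_assoc, ← Real.exp_add]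
      simp
  set U : ℝ →ᵇ ℝ := ContractingWith.fixedPoint Φ hΦ with hU
  refine ⟨Z U, hsol _ hΦ.fixedPoint_isFixedPt, fun z hz => ?_⟩
  let u₀ : ℝ → ℝ := fun t => Real.exp (l * min t 0) * (z t - v * t)
  have hZu : Z u₀ = z := by
    funext t
    simp only [Z, u₀]
    rw [← mul_assoc, ← Real.exp_add]
    simp
  have hΨu : Ψ z = u₀ := by
    funext t
    simp only [Ψ, u₀]
    rcases le_total t 0 with ht | ht
    · rw [min_eq_left ht, hint_eq _ hz.continuous, hz.eq_integral t ht]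
    · rw [min_eq_right ht, hz.eq_of_nonneg t ht]; simp
  let u : ℝ →ᵇ ℝ := BoundedContinuousFunction.ofNormedAddCommGroup u₀
    (hΨu ▸ hΨc _ hz.continuous) ((M + |v|) * (1 / l)) (fun t => hΨu ▸ hΨb z t)
  have hfix : Φ u = u := by
    ext t
    change Ψ (Z u₀) t = u₀ t
    rw [hZu, hΨu]
  rw [hU, ← hΦ.fixedPoint_unique hfix]
  exact hZu.symm

end FollowTheLeaders

namespace FollowTheLeaders

variable {φ w : ℝ → ℝ} {ℓ h Vm Vp g : ℝ} {a : ℕ → ℝ}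

/-! ### Platoons of cars -/

/-- The piecewise constant density of cars of length `ℓ` at the positions `a 0 < a 1 < …`. -/
noncomputable def carDensity (ℓ : ℝ) (a : ℕ → ℝ) (y : ℝ) : ℝ :=
  ∑' k : ℕ, (Ico (a k) (a (k + 1))).indicator (fun _ => ℓ / (a (k + 1) - a k)) y

/-- Car positions whose gaps are at least `g` and do not increase in the driving direction. -/
structure IsPlatoon (g : ℝ) (a : ℕ → ℝ) : Prop where
  le_gap : ∀ k, g ≤ a (k + 1) - a k
  gap_anti : ∀ k, a (k + 2) - a (k + 1) ≤ a (k + 1) - a k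

lemma stepDensity_eq_carDensity (ℓ : ℝ) (P : ℝ → ℝ) (hℓ : ℓ ≠ 0) (x : ℝ) :
    stepDensity ℓ P x = carDensity ℓ fun k => (leader ℓ P)^[k] x := by
  funext y
  unfold stepDensity carDensity
  refine tsum_congr fun k => ?_
  congr 1
  funext _
  simp only [Function.iterate_succ_apply', leader, add_sub_cancel_left]
  rw [div_div_cancel₀ hℓ]

namespace IsPlatoon

lemma strictMono (ha : IsPlatoon g a) (hg : 0 < g) : StrictMono a :=
  strictMono_nat_of_lt_succ fun k => by linarith [ha.le_gap k]

lemma antitone_gap (ha : IsPlatoon g a) : Antitone fun k => a (k + 1) - a k :=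
  antitone_nat_of_succ_le fun k => ha.gap_anti k

lemma tail (ha : IsPlatoon g a) : IsPlatoon g fun k => a (k + 1) :=
  ⟨fun k => ha.le_gap (k + 1), fun k => ha.gap_anti (k + 1)⟩

lemma add_mul_le (ha : IsPlatoon g a) (k : ℕ) : a 0 + k * g ≤ a k := by
  induction k with
  | zero => simp
  | succ k ih =>
    push_cast
    linarith [ha.le_gap k]

lemma exists_mem_Ico (ha : IsPlatoon g a) (hg : 0 < g) {y : ℝ} (hy : a 0 ≤ y) :
    ∃ k, y ∈ Ico (a k) (a (k + 1)) := by
  have hex : ∃ n, y < a n := by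
    obtain ⟨n, hn⟩ := exists_nat_gt ((y - a 0) / g)
    rw [div_lt_iff₀ hg] at hn
    exact ⟨n, by linarith [ha.add_mul_le n]⟩
  classical
  obtain ⟨k, hk⟩ : ∃ k, Nat.find hex = k + 1 := Nat.exists_eq_succ_of_ne_zero fun h0 => by
    have := Nat.find_spec hex
    rw [h0] at this
    exact not_lt.2 hy this
  refine ⟨k, not_lt.1 (Nat.find_min hex (by omega)), ?_⟩
  rw [← hk]
  exact Nat.find_spec hex

lemma carDensity_eq (ha : IsPlatoon g a) (hg : 0 < g) {y : ℝ} {k : ℕ}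
    (hy : y ∈ Ico (a k) (a (k + 1))) : carDensity ℓ a y = ℓ / (a (k + 1) - a k) := by
  unfold carDensity
  rw [tsum_eq_single k, indicator_of_mem hy]
  intro j hj
  refine indicator_of_notMem (fun hm => hj ?_) _
  have h1 := (ha.strictMono hg).lt_iff_lt.1 (hy.1.trans_lt hm.2)
  have h2 := (ha.strictMono hg).lt_iff_lt.1 (hm.1.trans_lt hy.2)
  omega

lemma carDensity_tail (ha : IsPlatoon g a) (hg : 0 < g) {y : ℝ} (hy : a 1 ≤ y) :
    carDensity ℓ (fun k => a (k + 1)) y = carDensity ℓ a y := by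
  obtain ⟨k, hk⟩ := ha.tail.exists_mem_Ico hg hy
  rw [ha.tail.carDensity_eq hg hk, ha.carDensity_eq (k := k + 1) hg hk]

lemma monotoneOn_carDensity (ha : IsPlatoon g a) (hg : 0 < g) (hℓ : 0 < ℓ) :
    MonotoneOn (carDensity ℓ a) (Ici (a 0)) := by
  intro y hy y' hy' hyy
  obtain ⟨k, hk⟩ := ha.exists_mem_Ico hg hy
  obtain ⟨j, hj⟩ := ha.exists_mem_Ico hg hy'
  rw [ha.carDensity_eq hg hk, ha.carDensity_eq hg hj]
  have h1 := (ha.strictMono hg).lt_iff_lt.1 ((hk.1.trans hyy).trans_lt hj.2)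
  exact div_le_div_of_nonneg_left hℓ.le (by linarith [ha.le_gap j])
    (ha.antitone_gap (by omega : k ≤ j))

lemma carDensity_pos (ha : IsPlatoon g a) (hg : 0 < g) (hℓ : 0 < ℓ) {y : ℝ} (hy : a 0 ≤ y) :
    0 < carDensity ℓ a y := by
  obtain ⟨k, hk⟩ := ha.exists_mem_Ico hg hy
  rw [ha.carDensity_eq hg hk]
  exact div_pos hℓ (by linarith [ha.le_gap k])

lemma carDensity_le (ha : IsPlatoon g a) (hg : 0 < g) (hℓ : 0 < ℓ) {y : ℝ} (hy : a 0 ≤ y) :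
    carDensity ℓ a y ≤ ℓ / g := by
  obtain ⟨k, hk⟩ := ha.exists_mem_Ico hg hy
  rw [ha.carDensity_eq hg hk]
  exact div_le_div_of_nonneg_left hℓ.le hg (ha.le_gap k)

lemma carDensity_mem_Icc (ha : IsPlatoon g a) (hg : 0 < g) (hℓ : 0 < ℓ) (hℓg : ℓ ≤ g) {y : ℝ}
    (hy : a 0 ≤ y) : carDensity ℓ a y ∈ Icc (0 : ℝ) 1 :=
  ⟨(ha.carDensity_pos hg hℓ hy).le, (ha.carDensity_le hg hℓ hy).trans ((div_le_one hg).2 hℓg)⟩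

end IsPlatoon

/-! ### Averaged velocities -/

lemma speedLimit_antitone (hV : Vp ≤ Vm) : Antitone (speedLimit Vm Vp) := by
  intro x y hxy
  unfold speedLimit
  split_ifs <;> first | exact le_rfl | exact hV | (exfalso; linarith)

lemma le_speedLimit (hV : Vp ≤ Vm) (x : ℝ) : Vp ≤ speedLimit Vm Vp x := by
  unfold speedLimit
  split_ifs
  exacts [hV, le_rfl]

lemma speedLimit_le (hV : Vp ≤ Vm) (x : ℝ) : speedLimit Vm Vp x ≤ Vm := by
  unfold speedLimit
  split_ifs
  exacts [le_rfl, hV]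

/-- The standing assumptions: `g` is a lower bound for the gaps between cars of length `ℓ`. -/
structure IsModel (ℓ h Vm Vp : ℝ) (φ w : ℝ → ℝ) (g : ℝ) : Prop where
  length_pos : 0 < ℓ
  window_pos : 0 < h
  length_le : ℓ ≤ g
  pos : 0 < Vp
  lt : Vp < Vm
  velocity : IsVelocity φ
  weight : IsWeight h w

namespace IsModel

lemma gap_pos (M : IsModel ℓ h Vm Vp φ w g) : 0 < g := M.length_pos.trans_le M.length_le

lemma speedLimit_pos (M : IsModel ℓ h Vm Vp φ w g) (x : ℝ) : 0 < speedLimit Vm Vp x :=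
  M.pos.trans_le (le_speedLimit M.lt.le x)

lemma density_mem (M : IsModel ℓ h Vm Vp φ w g) {r : ℝ} (hr : g ≤ r) :
    ℓ / r ∈ Icc (0 : ℝ) 1 :=
  ⟨div_nonneg M.length_pos.le (M.gap_pos.le.trans hr),
    (div_le_one (M.gap_pos.trans_le hr)).2 (M.length_le.trans hr)⟩

lemma antitoneOn_velocity (M : IsModel ℓ h Vm Vp φ w g) (ha : IsPlatoon g a) :
    AntitoneOn (fun y => speedLimit Vm Vp y * φ (carDensity ℓ a y)) (Ici (a 0)) := by
  intro y hy y' hy' hyy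
  have m1 := ha.carDensity_mem_Icc M.gap_pos M.length_pos M.length_le hy
  have m2 := ha.carDensity_mem_Icc M.gap_pos M.length_pos M.length_le hy'
  exact mul_le_mul (speedLimit_antitone M.lt.le hyy)
    (M.velocity.strictAntiOn.antitoneOn m1 m2
      (ha.monotoneOn_carDensity M.gap_pos M.length_pos hy hy' hyy))
    (M.velocity.mapsTo m2).1 (M.speedLimit_pos y).le

lemma avgVelocity_le (M : IsModel ℓ h Vm Vp φ w g) (ha : IsPlatoon g a) :
    avgVelocity h Vm Vp φ w (carDensity ℓ a) (a 0)
      ≤ speedLimit Vm Vp (a 0) * φ (ℓ / (a 1 - a 0)) := by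
  have h0 : a 0 ∈ Ico (a 0) (a (0 + 1)) :=
    ⟨le_rfl, ha.strictMono M.gap_pos (Nat.lt_succ_self 0)⟩
  rw [← ha.carDensity_eq M.gap_pos h0]
  have hm := M.antitoneOn_velocity ha
  exact M.weight.average_le M.window_pos hm fun y hy => hm self_mem_Ici hy.1 hy.1

lemma le_avgVelocity (M : IsModel ℓ h Vm Vp φ w g) (ha : IsPlatoon g a) :
    speedLimit Vm Vp (a 0 + h) * φ (carDensity ℓ a (a 0 + h))
      ≤ avgVelocity h Vm Vp φ w (carDensity ℓ a) (a 0) := by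
  have hm := M.antitoneOn_velocity ha
  have hh := M.window_pos
  exact M.weight.le_average M.window_pos hm fun y hy =>
    hm hy.1 (by simp; linarith) hy.2

lemma free_le_avgVelocity (M : IsModel ℓ h Vm Vp φ w g) (ha : IsPlatoon g a) :
    Vp * φ (ℓ / g) ≤ avgVelocity h Vm Vp φ w (carDensity ℓ a) (a 0) := by
  refine le_trans ?_ (M.le_avgVelocity ha)
  have hh := M.window_pos
  have hy : a 0 ≤ a 0 + h := by linarith
  have hmem := M.density_mem le_rfl
  exact mul_le_mul (le_speedLimit M.lt.le _)
    (M.velocity.strictAntiOn.antitoneOn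
      (ha.carDensity_mem_Icc M.gap_pos M.length_pos M.length_le hy) hmem
      (ha.carDensity_le M.gap_pos M.length_pos hy))
    (M.velocity.mapsTo hmem).1 (M.speedLimit_pos _).le

lemma avgVelocity_tail (M : IsModel ℓ h Vm Vp φ w g) (ha : IsPlatoon g a) :
    avgVelocity h Vm Vp φ w (carDensity ℓ fun k => a (k + 1)) (a 1)
      = avgVelocity h Vm Vp φ w (carDensity ℓ a) (a 1) := by
  refine intervalIntegral.integral_congr fun y hy => ?_
  have hh := M.window_pos
  rw [uIcc_of_le (by linarith)] at hy
  simp only [ha.carDensity_tail M.gap_pos hy.1]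

/-- In a platoon every car is at least as fast as its leader: it sees a higher speed limit and a
lower density. -/
lemma avgVelocity_tail_le (M : IsModel ℓ h Vm Vp φ w g) (ha : IsPlatoon g a) :
    avgVelocity h Vm Vp φ w (carDensity ℓ fun k => a (k + 1)) (a 1)
      ≤ avgVelocity h Vm Vp φ w (carDensity ℓ a) (a 0) := by
  rw [M.avgVelocity_tail ha]
  exact M.weight.average_anti M.window_pos (M.antitoneOn_velocity ha)
    (ha.strictMono M.gap_pos (Nat.lt_succ_self 0)).le

lemma avgVelocity_eq_free (M : IsModel ℓ h Vm Vp φ w g) (ha : IsPlatoon g a) (h0 : 0 ≤ a 0)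
    (hgap : a 1 - a 0 = g) :
    avgVelocity h Vm Vp φ w (carDensity ℓ a) (a 0) = Vp * φ (ℓ / g) := by
  refine le_antisymm ((M.avgVelocity_le ha).trans_eq ?_) (M.free_le_avgVelocity ha)
  rw [hgap, speedLimit, if_neg (not_lt.2 h0)]

end IsModel

/-- A primitive, in `y`, of `V(y) w(y - c)` on `y ≥ c`. -/
noncomputable def weightedLimit (Vm Vp : ℝ) (w : ℝ → ℝ) (y c : ℝ) : ℝ :=
  Vm * cumWeight w (min y 0 - c) + Vp * cumWeight w (max y 0 - c)

lemma IsWeight.integral_shift (hw : IsWeight h w) (hh : 0 < h) (c p q : ℝ) :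
    ∫ y in p..q, w (y - c) = cumWeight w (q - c) - cumWeight w (p - c) := by
  rw [intervalIntegral.integral_comp_sub_right, cumWeight, cumWeight,
    intervalIntegral.integral_interval_sub_left (hw.intervalIntegrable hh _ _)
      (hw.intervalIntegrable hh _ _)]

lemma IsModel.integral_speedLimit_mul (M : IsModel ℓ h Vm Vp φ w g) {c p q : ℝ} (hp : c ≤ p)
    (hq : p ≤ q) : ∫ y in p..q, speedLimit Vm Vp y * w (y - c)
      = weightedLimit Vm Vp w q c - weightedLimit Vm Vp w p c := by
  have hneg : ∀ p q : ℝ, p ≤ q → q ≤ 0 → ∫ y in p..q, speedLimit Vm Vp y * w (y - c)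
      = weightedLimit Vm Vp w q c - weightedLimit Vm Vp w p c := by
    intro p q hpq hq
    have : ∫ y in p..q, speedLimit Vm Vp y * w (y - c) = ∫ y in p..q, Vm * w (y - c) :=
      intervalIntegral.integral_congr_uIoo fun y hy => by
        rw [uIoo_of_le hpq] at hy
        simp only [speedLimit, if_pos (hy.2.trans_le hq)]
    rw [this, intervalIntegral.integral_const_mul, M.weight.integral_shift M.window_pos]
    simp only [weightedLimit, min_eq_left hq, max_eq_right hq, min_eq_left (hpq.trans hq),
      max_eq_right (hpq.trans hq)]
    ring
  have hpos : ∀ p q : ℝ, p ≤ q → 0 ≤ p → ∫ y in p..q, speedLimit Vm Vp y * w (y - c)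
      = weightedLimit Vm Vp w q c - weightedLimit Vm Vp w p c := by
    intro p q hpq hp
    have : ∫ y in p..q, speedLimit Vm Vp y * w (y - c) = ∫ y in p..q, Vp * w (y - c) :=
      intervalIntegral.integral_congr_uIoo fun y hy => by
        rw [uIoo_of_le hpq] at hy
        simp only [speedLimit, if_neg (not_lt.2 (hp.trans hy.1.le))]
    rw [this, intervalIntegral.integral_const_mul, M.weight.integral_shift M.window_pos]
    simp only [weightedLimit, min_eq_right hp, max_eq_left hp, min_eq_right (hp.trans hpq),
      max_eq_left (hp.trans hpq)]
    ring
  rcases le_total q 0 with h1 | h1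
  · exact hneg p q hq h1
  rcases le_total 0 p with h2 | h2
  · exact hpos p q hq h2
  have hanti : AntitoneOn (speedLimit Vm Vp) (Ici c) :=
    (speedLimit_antitone M.lt.le).antitoneOn _
  rw [← intervalIntegral.integral_add_adjacent_intervals
    (M.weight.intervalIntegrable_mul M.window_pos hanti hp (hp.trans h2))
    (M.weight.intervalIntegrable_mul M.window_pos hanti (hp.trans h2) (hp.trans hq)),
    hneg p 0 h2 le_rfl, hpos 0 q h1 le_rfl]
  ring

lemma IsModel.avgVelocity_eq_sum (M : IsModel ℓ h Vm Vp φ w g) (ha : IsPlatoon g a) {N : ℕ}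
    (hN : h ≤ N * g) :
    avgVelocity h Vm Vp φ w (carDensity ℓ a) (a 0) = ∑ k ∈ Finset.range N,
      φ (ℓ / (a (k + 1) - a k)) *
        (weightedLimit Vm Vp w (a (k + 1)) (a 0) - weightedLimit Vm Vp w (a k) (a 0)) := by
  have hmono := ha.strictMono M.gap_pos
  have h0 : ∀ k, a 0 ≤ a k := fun k => hmono.monotone (Nat.zero_le k)
  have hh := M.window_pos
  have hint : ∀ p q, a 0 ≤ p → a 0 ≤ q → IntervalIntegrable (fun y =>
      speedLimit Vm Vp y * φ (carDensity ℓ a y) * w (y - a 0)) MeasureTheory.volume p q :=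
    fun p q hp hq => M.weight.intervalIntegrable_mul hh (M.antitoneOn_velocity ha) hp hq
  have hend : a 0 + h ≤ a N := by linarith [ha.add_mul_le N]
  -- Beyond the look-ahead window the weight vanishes.
  have hzero : ∫ y in (a 0 + h)..(a N), speedLimit Vm Vp y * φ (carDensity ℓ a y) * w (y - a 0)
      = 0 := by
    refine (intervalIntegral.integral_congr_uIoo (g := fun _ => (0 : ℝ)) fun y hy => ?_).trans
      (by simp)
    rw [uIoo_of_le hend] at hy
    simp only
    rw [M.weight.eq_zero_of_notMem _ fun hm => ?_, mul_zero]
    linarith [hm.2, hy.1]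
  have hsplit := intervalIntegral.integral_add_adjacent_intervals
    (hint (a 0) (a 0 + h) le_rfl (by linarith)) (hint (a 0 + h) (a N) (by linarith) (h0 N))
  rw [hzero, add_zero] at hsplit
  unfold avgVelocity
  rw [hsplit, ← intervalIntegral.sum_integral_adjacent_intervals
    (fun k _ => hint (a k) (a (k + 1)) (h0 _) (h0 _))]
  refine Finset.sum_congr rfl fun k _ => ?_
  have hk : a k ≤ a (k + 1) := hmono.monotone (Nat.le_succ k)
  rw [← M.integral_speedLimit_mul (h0 k) hk, ← intervalIntegral.integral_const_mul]
  refine intervalIntegral.integral_congr_uIoo fun y hy => ?_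
  rw [uIoo_of_le hk] at hy
  rw [ha.carDensity_eq M.gap_pos ⟨hy.1.le, hy.2⟩]
  ring

end FollowTheLeaders

namespace FollowTheLeaders

variable {φ w : ℝ → ℝ} {ℓ h Vm Vp g : ℝ} {a : ℕ → ℝ}

/-! ### Regularity of functions of a sequence -/

/-- `F` is continuous for the product topology and Lipschitz continuous for the uniform distance
of sequences. -/
def SupRegular (F : (ℕ → ℝ) → ℝ) : Prop :=
  Continuous F ∧ ∃ K, 0 ≤ K ∧ SupLipschitz K F

namespace SupRegular

variable {F G : (ℕ → ℝ) → ℝ}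

lemma apply (k : ℕ) : SupRegular fun a => a k :=
  ⟨continuous_apply k, 1, zero_le_one, fun a b δ hab => by simpa using hab k⟩

lemma add (hF : SupRegular F) (hG : SupRegular G) : SupRegular fun a => F a + G a := by
  obtain ⟨cF, K, hK, lF⟩ := hF
  obtain ⟨cG, L, hL, lG⟩ := hG
  refine ⟨cF.add cG, K + L, add_nonneg hK hL, fun a b δ hab => ?_⟩
  rw [add_sub_add_comm, add_mul]
  exact (abs_add_le _ _).trans (add_le_add (lF a b δ hab) (lG a b δ hab))

lemma comp {f : ℝ → ℝ} {C : ℝ} (hC : 0 ≤ C) (hf : ∀ s t, |f s - f t| ≤ C * |s - t|)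
    (hF : SupRegular F) : SupRegular fun a => f (F a) := by
  obtain ⟨cF, K, hK, lF⟩ := hF
  have cf : Continuous f := (LipschitzWith.of_dist_le_mul (K := ⟨C, hC⟩) hf).continuous
  refine ⟨cf.comp cF, C * K, mul_nonneg hC hK, fun a b δ hab => (hf _ _).trans ?_⟩
  rw [mul_assoc]
  exact mul_le_mul_of_nonneg_left (lF a b δ hab) hC

lemma const_mul (c : ℝ) (hF : SupRegular F) : SupRegular fun a => c * F a :=
  comp (abs_nonneg c) (fun s t => by rw [← mul_sub, abs_mul]) hF

lemma sub (hF : SupRegular F) (hG : SupRegular G) : SupRegular fun a => F a - G a := by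
  simpa [sub_eq_add_neg] using hF.add (hG.const_mul (-1))

lemma min (hF : SupRegular F) (hG : SupRegular G) : SupRegular fun a => min (F a) (G a) := by
  obtain ⟨cF, K, hK, lF⟩ := hF
  obtain ⟨cG, L, hL, lG⟩ := hG
  refine ⟨cF.min cG, max K L, le_max_of_le_left hK, fun a b δ hab => ?_⟩
  have hδ : 0 ≤ δ := (abs_nonneg _).trans (hab 0)
  refine (abs_min_sub_min_le_max _ _ _ _).trans (max_le ?_ ?_)
  · exact (lF a b δ hab).trans (mul_le_mul_of_nonneg_right (le_max_left _ _) hδ)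
  · exact (lG a b δ hab).trans (mul_le_mul_of_nonneg_right (le_max_right _ _) hδ)

lemma mul {A B : ℝ} (hF : SupRegular F) (hG : SupRegular G) (hA : ∀ a, |F a| ≤ A)
    (hB : ∀ a, |G a| ≤ B) : SupRegular fun a => F a * G a := by
  obtain ⟨cF, K, hK, lF⟩ := hF
  obtain ⟨cG, L, hL, lG⟩ := hG
  have hA0 : 0 ≤ A := (abs_nonneg _).trans (hA 0)
  have hB0 : 0 ≤ B := (abs_nonneg _).trans (hB 0)
  refine ⟨cF.mul cG, A * L + K * B, by positivity, fun a b δ hab => ?_⟩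
  have h1 : F a * G a - F b * G b = F a * (G a - G b) + (F a - F b) * G b := by ring
  have hδ : 0 ≤ δ := (abs_nonneg _).trans (hab 0)
  rw [h1]
  refine (abs_add_le _ _).trans ?_
  rw [abs_mul, abs_mul]
  calc _ ≤ A * (L * δ) + K * δ * B := by
        gcongr
        exacts [hA a, lG a b δ hab, lF a b δ hab, hB b]
    _ = _ := by ring

lemma sum {ι : Type*} (s : Finset ι) {F : ι → (ℕ → ℝ) → ℝ} (hF : ∀ i ∈ s, SupRegular (F i)) :
    SupRegular fun a => ∑ i ∈ s, F i a := by
  classical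
  induction s using Finset.induction_on with
  | empty => exact ⟨by simpa using continuous_const, 0, le_rfl, fun a b δ _ => by simp⟩
  | insert i s hi ih =>
    simp only [Finset.sum_insert hi]
    exact (hF i (Finset.mem_insert_self i s)).add
      (ih fun j hj => hF j (Finset.mem_insert_of_mem hj))

end SupRegular

/-! ### The velocity as a function of the car positions -/

/-- The velocity `φ(ℓ / r)` in a gap `r`, cut off at the smallest admissible gap `g`. -/
noncomputable def gapVelocity (φ : ℝ → ℝ) (ℓ g r : ℝ) : ℝ := φ (ℓ / max r g)

/-- The velocity of the first car of a row `c`, as a finite sum over the first `N` gaps. It is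
defined for arbitrary positions. -/
noncomputable def rowVelocity (ℓ Vm Vp : ℝ) (φ w : ℝ → ℝ) (g : ℝ) (N : ℕ) (c : ℕ → ℝ) : ℝ :=
  ∑ k ∈ Finset.range N, gapVelocity φ ℓ g (c (k + 1) - c k) *
    (weightedLimit Vm Vp w (c (k + 1)) (c 0) - weightedLimit Vm Vp w (c k) (c 0))

/-- Moves the first car of a row back, if necessary, so that its gap is at least the next one. -/
noncomputable def spreadFirst (a : ℕ → ℝ) (k : ℕ) : ℝ :=
  if k = 0 then min (a 0) (2 * a 1 - a 2) else a k

/-- The right-hand side of the modified equation of motion. The modification is invisible along a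
platoon, and makes every car with a platoon in front of it at least as fast as its leader. -/
noncomputable def spreadVelocity (ℓ Vm Vp : ℝ) (φ w : ℝ → ℝ) (g : ℝ) (N : ℕ) (a : ℕ → ℝ) : ℝ :=
  rowVelocity ℓ Vm Vp φ w g N (spreadFirst a)

lemma spreadFirst_eq_self (ha : IsPlatoon g a) : spreadFirst a = a := by
  funext k
  unfold spreadFirst
  split_ifs with hk
  · rw [hk]
    exact min_eq_left (by linarith [ha.gap_anti 0])
  · rfl

lemma isPlatoon_spreadFirst (ha : IsPlatoon g fun k => a (k + 1)) :
    IsPlatoon g (spreadFirst a) := by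
  have h0 : spreadFirst a 0 ≤ 2 * a 1 - a 2 := by simp [spreadFirst]
  have hs : ∀ k, spreadFirst a (k + 1) = a (k + 1) := fun k => by simp [spreadFirst]
  have hg : g ≤ a 2 - a 1 := ha.le_gap 0
  constructor
  · rintro (_ | k)
    · rw [hs]; linarith
    · rw [hs, hs]; exact ha.le_gap k
  · rintro (_ | k)
    · rw [hs, hs]; norm_num; linarith
    · rw [hs, hs, hs]; exact ha.gap_anti k

lemma IsWeight.cumWeight_mem (hw : IsWeight h w) (hh : 0 < h) (s : ℝ) :
    cumWeight w s ∈ Icc (0 : ℝ) 1 := by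
  have hmono : Monotone (cumWeight w) := by
    intro p q hpq
    have := hw.integral_shift hh 0 p q
    simp only [sub_zero] at this
    linarith [intervalIntegral.integral_nonneg
      (μ := MeasureTheory.volume) hpq fun x _ => hw.nonneg x]
  have hle : ∀ p ≤ 0, cumWeight w p = 0 := fun p hp => by
    refine (intervalIntegral.integral_congr_uIoo (g := fun _ => (0 : ℝ)) fun y hy => ?_).trans
      (by simp)
    rw [uIoo_of_ge hp] at hy
    exact hw.eq_zero_of_notMem _ fun hm => not_lt.2 hm.1 hy.2
  have hge : ∀ p, h ≤ p → cumWeight w p = 1 := fun p hp => by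
    have h1 := hw.integral_shift hh 0 h p
    simp only [sub_zero] at h1
    have h2 : ∫ y in h..p, w y = 0 := by
      refine (intervalIntegral.integral_congr_uIoo (g := fun _ => (0 : ℝ)) fun y hy => ?_).trans
        (by simp)
      rw [uIoo_of_le hp] at hy
      exact hw.eq_zero_of_notMem _ fun hm => not_lt.2 hm.2 hy.1
    have h3 : cumWeight w h = 1 := hw.integral_eq_one
    linarith
  exact ⟨(hle _ (min_le_right s 0)).symm.le.trans (hmono (min_le_left s 0)),
    (hmono (le_max_left s h)).trans (hge _ (le_max_right s h)).le⟩

namespace IsModel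

lemma exists_lipschitz_gapVelocity (M : IsModel ℓ h Vm Vp φ w g) :
    ∃ C, 0 ≤ C ∧ ∀ r s, |gapVelocity φ ℓ g r - gapVelocity φ ℓ g s| ≤ C * |r - s| := by
  obtain ⟨K, hK⟩ := M.velocity.exists_lipschitzOnWith
  have hg := M.gap_pos
  have hℓ := M.length_pos
  refine ⟨K * (ℓ / (g * g)), by positivity, fun r s => ?_⟩
  have h1 := hK.dist_le_mul _ (M.density_mem (le_max_right r g)) _
    (M.density_mem (le_max_right s g))
  rw [Real.dist_eq, Real.dist_eq] at h1
  refine h1.trans ?_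
  rw [mul_assoc]
  refine mul_le_mul_of_nonneg_left ?_ K.2
  have hr : g ≤ max r g := le_max_right r g
  have hs : g ≤ max s g := le_max_right s g
  have hr0 := hg.trans_le hr
  have hs0 := hg.trans_le hs
  have h2 : ℓ / max r g - ℓ / max s g = ℓ / (max r g * max s g) * (max s g - max r g) := by
    field_simp
  rw [h2, abs_mul, abs_of_pos (by positivity)]
  have h3 : |max s g - max r g| ≤ |r - s| := by
    rw [abs_sub_comm r s]
    exact abs_max_sub_max_le_abs s r g
  gcongr

lemma abs_gapVelocity_le (M : IsModel ℓ h Vm Vp φ w g) (r : ℝ) : |gapVelocity φ ℓ g r| ≤ 1 := by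
  have := M.velocity.mapsTo (M.density_mem (le_max_right r g))
  rw [gapVelocity, abs_of_nonneg this.1]
  exact this.2

lemma weightedLimit_mem (M : IsModel ℓ h Vm Vp φ w g) (y c : ℝ) :
    weightedLimit Vm Vp w y c ∈ Icc 0 (Vm + Vp) := by
  have h1 := M.weight.cumWeight_mem M.window_pos (min y 0 - c)
  have h2 := M.weight.cumWeight_mem M.window_pos (max y 0 - c)
  have hp := M.pos
  have hm := M.pos.trans M.lt
  unfold weightedLimit
  constructor
  · have := mul_nonneg hm.le h1.1
    have := mul_nonneg hp.le h2.1
    linarith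
  · nlinarith [h1.2, h2.2]

lemma abs_weightedLimit_sub_le (M : IsModel ℓ h Vm Vp φ w g) (y y' c : ℝ) :
    |weightedLimit Vm Vp w y c - weightedLimit Vm Vp w y' c| ≤ Vm + Vp := by
  have h1 := M.weightedLimit_mem y c
  have h2 := M.weightedLimit_mem y' c
  rw [abs_le]
  constructor <;> linarith [h1.1, h1.2, h2.1, h2.2]

lemma abs_spreadVelocity_le (M : IsModel ℓ h Vm Vp φ w g) (N : ℕ) (a : ℕ → ℝ) :
    |spreadVelocity ℓ Vm Vp φ w g N a| ≤ N * (Vm + Vp) := by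
  unfold spreadVelocity rowVelocity
  refine (Finset.abs_sum_le_sum_abs _ _).trans ?_
  refine (Finset.sum_le_card_nsmul _ _ (Vm + Vp) fun k _ => ?_).trans_eq
    (by simp [mul_add])
  rw [abs_mul]
  have hp := M.pos
  have hm := M.pos.trans M.lt
  calc _ ≤ 1 * (Vm + Vp) := by
        gcongr
        exacts [M.abs_gapVelocity_le _, M.abs_weightedLimit_sub_le _ _ _]
    _ = _ := one_mul _

lemma supRegular_spreadVelocity (M : IsModel ℓ h Vm Vp φ w g) (N : ℕ) :
    SupRegular (spreadVelocity ℓ Vm Vp φ w g N) := by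
  obtain ⟨C, hC, hφ⟩ := M.exists_lipschitz_gapVelocity
  obtain ⟨L, hL, hW⟩ := M.weight.exists_lipschitz_cumWeight M.window_pos
  have hc : ∀ k, SupRegular fun a => spreadFirst a k := by
    intro k
    unfold spreadFirst
    split_ifs
    · exact (SupRegular.apply 0).min (((SupRegular.apply 1).const_mul 2).sub (SupRegular.apply 2))
    · exact SupRegular.apply k
  have hB : ∀ k, SupRegular fun a =>
      weightedLimit Vm Vp w (spreadFirst a k) (spreadFirst a 0) := by
    intro k
    have h1 : SupRegular fun a => min (spreadFirst a k) 0 :=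
      SupRegular.comp (f := fun s => min s 0) zero_le_one
        (fun s t => by simpa using abs_min_sub_min_le_max s 0 t 0) (hc k)
    have h2 : SupRegular fun a => max (spreadFirst a k) 0 :=
      SupRegular.comp (f := fun s => max s 0) zero_le_one
        (fun s t => by rw [one_mul]; exact abs_max_sub_max_le_abs s t 0) (hc k)
    exact ((SupRegular.comp hL hW (h1.sub (hc 0))).const_mul Vm).add
      ((SupRegular.comp hL hW (h2.sub (hc 0))).const_mul Vp)
  unfold spreadVelocity rowVelocity
  refine SupRegular.sum _ fun k _ => ?_
  exact (SupRegular.comp hC hφ ((hc (k + 1)).sub (hc k))).mul ((hB (k + 1)).sub (hB k))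
    (fun _ => M.abs_gapVelocity_le _) (fun _ => M.abs_weightedLimit_sub_le _ _ _)

lemma rowVelocity_eq (M : IsModel ℓ h Vm Vp φ w g) (ha : IsPlatoon g a) {N : ℕ}
    (hN : h ≤ N * g) :
    rowVelocity ℓ Vm Vp φ w g N a = avgVelocity h Vm Vp φ w (carDensity ℓ a) (a 0) := by
  rw [M.avgVelocity_eq_sum ha hN]
  refine Finset.sum_congr rfl fun k _ => ?_
  rw [gapVelocity, max_eq_left (ha.le_gap k)]

lemma spreadVelocity_eq (M : IsModel ℓ h Vm Vp φ w g) (ha : IsPlatoon g a) {N : ℕ}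
    (hN : h ≤ N * g) :
    spreadVelocity ℓ Vm Vp φ w g N a = avgVelocity h Vm Vp φ w (carDensity ℓ a) (a 0) := by
  rw [spreadVelocity, spreadFirst_eq_self ha, M.rowVelocity_eq ha hN]

lemma spreadVelocity_tail_le (M : IsModel ℓ h Vm Vp φ w g) {N : ℕ} (hN : h ≤ N * g)
    (ha : IsPlatoon g fun k => a (k + 1)) :
    spreadVelocity ℓ Vm Vp φ w g N (fun k => a (k + 1))
      ≤ spreadVelocity ℓ Vm Vp φ w g N a := by
  have hs : (fun k => a (k + 1)) = fun k => spreadFirst a (k + 1) := by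
    funext k; simp [spreadFirst]
  have hp := isPlatoon_spreadFirst ha
  rw [M.spreadVelocity_eq ha hN, spreadVelocity, M.rowVelocity_eq hp hN, hs]
  have := M.avgVelocity_tail_le hp
  simpa [spreadFirst] using this

end IsModel

end FollowTheLeaders

namespace FollowTheLeaders

variable {φ w z : ℝ → ℝ} {ℓ h Vm Vp g T : ℝ}

/-! ### The common path of the cars -/

lemma exists_inverse_of_le_deriv {F F' : ℝ → ℝ} {c : ℝ} (hc : 0 < c)
    (hF : ∀ t, HasDerivAt F (F' t) t) (hle : ∀ t, c ≤ F' t) :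
    ∃ G : ℝ → ℝ, (∀ x, F (G x) = x) ∧ (∀ t, G (F t) = t) ∧ StrictMono G ∧
      ∀ x, HasDerivAt G (F' (G x))⁻¹ x := by
  have hpos : ∀ t, 0 < F' t := fun t => hc.trans_le (hle t)
  have hmono : StrictMono F := strictMono_of_deriv_pos fun t => by rw [(hF t).deriv]; exact hpos t
  have hsub : Monotone fun t => F t - c * t := by
    refine monotone_of_deriv_nonneg (fun t => ?_) fun t => ?_
    · exact ((hF t).sub ((hasDerivAt_id t).const_mul c)).differentiableAt
    · rw [((hF t).fun_sub ((hasDerivAt_id' t).const_mul c)).deriv]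
      linarith [hle t]
  have hcont : Continuous F := continuous_iff_continuousAt.2 fun t => (hF t).continuousAt
  have hsurj : Function.Surjective F := by
    refine hcont.surjective ?_ ?_
    · refine tendsto_atTop_mono' atTop (f₁ := fun t => F 0 + c * t) ?_ ?_
      · filter_upwards [eventually_ge_atTop 0] with t ht
        have := hsub ht
        simp only at this
        linarith
      · exact tendsto_atTop_add_const_left _ _ (tendsto_id.const_mul_atTop hc)
    · refine tendsto_atBot_mono' atBot (f₁ := fun t => F 0 + c * t) ?_ ?_
      · filter_upwards [eventually_le_atBot 0] with t ht
        have := hsub ht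
        simp only at this
        linarith
      · exact tendsto_atBot_add_const_left _ _ (tendsto_id.const_mul_atBot hc)
  let e := hmono.orderIsoOfSurjective F hsurj
  have h1 : ∀ x, F (e.symm x) = x := fun x => e.apply_symm_apply x
  refine ⟨e.symm, h1, fun t => e.symm_apply_apply t, e.symm.strictMono, fun x => ?_⟩
  exact HasDerivAt.of_local_left_inverse e.symm.continuous.continuousAt (hF _) (hpos _).ne'
    (Eventually.of_forall h1)

/-- The positions at time `t` of the cars that follow the path `z` at time intervals `T`, beginning
with the car at `z t`. -/
def row (T : ℝ) (z : ℝ → ℝ) (t : ℝ) (k : ℕ) : ℝ := z (t + k * T)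

lemma row_zero (T : ℝ) (z : ℝ → ℝ) (t : ℝ) : row T z t 0 = z t := by simp [row]

lemma row_one (T : ℝ) (z : ℝ → ℝ) (t : ℝ) : row T z t 1 = z (t + T) := by simp [row]

lemma row_tail (T : ℝ) (z : ℝ → ℝ) (t : ℝ) : (fun k => row T z t (k + 1)) = row T z (t + T) := by
  funext k
  simp only [row]
  congr 1
  push_cast
  ring

/-- The velocity of the car at `z t` if the path `z` is followed by all cars. -/
noncomputable def pathVelocity (ℓ h Vm Vp : ℝ) (φ w : ℝ → ℝ) (T : ℝ) (z : ℝ → ℝ) (t : ℝ) : ℝ :=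
  avgVelocity h Vm Vp φ w (carDensity ℓ (row T z t)) (z t)

/-- A path `z` that is followed by all cars, at time intervals `T`, under the follow-the-leaders
dynamics. At every time the cars form a platoon with gaps at least `g`, and for `t ≥ 0` the motion is
uniform, with the velocity that belongs to the gap `g`. -/
structure IsPath (ℓ h Vm Vp : ℝ) (φ w : ℝ → ℝ) (g T : ℝ) (z : ℝ → ℝ) : Prop where
  platoon : ∀ t, IsPlatoon g (row T z t)
  hasDerivAt : ∀ t, HasDerivAt z (pathVelocity ℓ h Vm Vp φ w T z t) t
  continuous_velocity : Continuous (pathVelocity ℓ h Vm Vp φ w T z)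
  eq_of_nonneg : ∀ t, 0 ≤ t → z t = Vp * φ (ℓ / g) * t

lemma IsModel.free_pos (M : IsModel ℓ h Vm Vp φ w g) (hℓg : ℓ < g) : 0 < Vp * φ (ℓ / g) :=
  mul_pos M.pos (M.velocity.pos (div_nonneg M.length_pos.le M.gap_pos.le)
    ((div_lt_one M.gap_pos).2 hℓg))

/-- The solution of the modified equation of motion is a path of the cars. The monotonicity of the
gaps propagates backwards in steps of length `T`: if the cars ahead form a platoon, the modified
velocity of a car is at least that of its leader, so its gap was larger before. -/
lemma IsModel.isPath_of_isAdvanceSolution (M : IsModel ℓ h Vm Vp φ w g) (hℓg : ℓ < g) {N : ℕ}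
    (hN : h ≤ N * g) (hT : T = g / (Vp * φ (ℓ / g)))
    (hz : IsAdvanceSolution (spreadVelocity ℓ Vm Vp φ w g N) T (Vp * φ (ℓ / g)) z) :
    IsPath ℓ h Vm Vp φ w g T z := by
  have hv := M.free_pos hℓg
  have hg := M.gap_pos
  have hT0 : 0 < T := hT ▸ div_pos hg hv
  have hvT : Vp * φ (ℓ / g) * T = g := by
    rw [hT, mul_div_cancel₀ _ hv.ne']
  have hgap_free : ∀ t, 0 ≤ t → z (t + T) - z t = g := fun t ht => by
    rw [hz.eq_of_nonneg _ ht, hz.eq_of_nonneg _ (by linarith)]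
    linarith
  have hgap : ∀ t k, row T z t (k + 1) - row T z t k = z ((t + k * T) + T) - z (t + k * T) := by
    intro t k
    simp only [row]
    congr 2
    push_cast
    ring
  have hplat : ∀ t₀, AntitoneOn (fun t => z (t + T) - z t) (Ici t₀) → ∀ t, t₀ ≤ t →
      IsPlatoon g (row T z t) := by
    intro t₀ hanti t ht
    have hmem : ∀ k : ℕ, t₀ ≤ t + k * T := fun k => by
      have : 0 ≤ (k : ℝ) * T := by positivity
      linarith
    constructor
    · intro k
      rw [hgap, ← hgap_free (max (t + k * T) 0) (le_max_right _ _)]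
      exact hanti (hmem k) ((hmem k).trans (le_max_left _ _)) (le_max_left _ _)
    · intro k
      refine (hgap t (k + 1)).trans_le (le_trans ?_ (hgap t k).ge)
      exact hanti (hmem k) (hmem (k + 1)) (by push_cast; nlinarith)
  have hbase : AntitoneOn (fun t => z (t + T) - z t) (Ici 0) := fun s hs t ht _ => by
    simp only
    rw [hgap_free s hs, hgap_free t ht]
  have hcont : Continuous fun t => spreadVelocity ℓ Vm Vp φ w g N (row T z t) :=
    (M.supRegular_spreadVelocity N).1.comp
      (continuous_pi fun k => hz.continuous.comp (by fun_prop))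
  have hvel : ∀ t, IsPlatoon g (row T z t) → spreadVelocity ℓ Vm Vp φ w g N (row T z t)
      = pathVelocity ℓ h Vm Vp φ w T z t := fun t ht => by
    rw [M.spreadVelocity_eq ht hN, row_zero, pathVelocity]
  have hint : ∀ t, z t = ∫ s in (0 : ℝ)..t, spreadVelocity ℓ Vm Vp φ w g N (row T z s) := by
    intro t
    rcases le_total t 0 with ht | ht
    · exact hz.eq_integral t ht
    · have : ∫ s in (0 : ℝ)..t, spreadVelocity ℓ Vm Vp φ w g N (row T z s)
          = ∫ s in (0 : ℝ)..t, Vp * φ (ℓ / g) := by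
        refine intervalIntegral.integral_congr fun s hs => ?_
        rw [uIcc_of_le ht] at hs
        have hp := hplat 0 hbase s hs.1
        rw [M.spreadVelocity_eq hp hN]
        refine M.avgVelocity_eq_free hp ?_ ?_
        · rw [row_zero, hz.eq_of_nonneg s hs.1]
          exact mul_nonneg hv.le hs.1
        · rw [row_one, row_zero, hgap_free s hs.1]
      rw [this, hz.eq_of_nonneg t ht, intervalIntegral.integral_const, sub_zero, smul_eq_mul,
        mul_comm]
  have hder : ∀ t, HasDerivAt z (spreadVelocity ℓ Vm Vp φ w g N (row T z t)) t := by
    intro t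
    have h1 := (hcont.integral_hasStrictDerivAt 0 t).hasDerivAt
    exact h1.congr_of_eventuallyEq (Eventually.of_forall hint)
  have hall : ∀ n : ℕ, AntitoneOn (fun t => z (t + T) - z t) (Ici (-(n * T))) := by
    intro n
    induction n with
    | zero => simpa using hbase
    | succ n ih =>
      have hd : ∀ t, HasDerivAt (fun t => z (t + T) - z t)
          (spreadVelocity ℓ Vm Vp φ w g N (row T z (t + T))
            - spreadVelocity ℓ Vm Vp φ w g N (row T z t)) t := fun t =>
        ((hder (t + T)).comp_add_const t T).fun_sub (hder t)
      refine antitoneOn_of_deriv_nonpos (convex_Ici _)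
        (fun t _ => (hd t).continuousAt.continuousWithinAt)
        (fun t _ => (hd t).differentiableAt.differentiableWithinAt) fun t ht => ?_
      rw [(hd t).deriv, sub_nonpos, ← row_tail]
      rw [interior_Ici, mem_Ioi] at ht
      push_cast at ht
      refine M.spreadVelocity_tail_le hN ?_
      rw [row_tail]
      exact hplat _ ih _ (by linarith)
  have hplat' : ∀ t, IsPlatoon g (row T z t) := by
    intro t
    obtain ⟨n, hn⟩ := exists_nat_ge (-t / T)
    rw [div_le_iff₀ hT0] at hn
    exact hplat _ (hall n) t (by linarith)
  refine ⟨hplat', fun t => hvel t (hplat' t) ▸ hder t, ?_, hz.eq_of_nonneg⟩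
  exact hcont.congr fun t => hvel t (hplat' t)

lemma IsModel.exists_le_mul (M : IsModel ℓ h Vm Vp φ w g) : ∃ N : ℕ, h ≤ N * g := by
  obtain ⟨N, hN⟩ := exists_nat_ge (h / g)
  exact ⟨N, (div_le_iff₀ M.gap_pos).1 hN⟩

/-! ### From the path to the profile -/

lemma IsModel.pathVelocity_tail (M : IsModel ℓ h Vm Vp φ w g)
    (hz : IsPath ℓ h Vm Vp φ w g T z) (t : ℝ) :
    avgVelocity h Vm Vp φ w (carDensity ℓ (row T z t)) (z (t + T))
      = pathVelocity ℓ h Vm Vp φ w T z (t + T) := by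
  rw [pathVelocity, ← row_tail, ← row_one T z t, M.avgVelocity_tail (hz.platoon t)]

lemma IsModel.free_le_pathVelocity (M : IsModel ℓ h Vm Vp φ w g)
    (hz : IsPath ℓ h Vm Vp φ w g T z) (t : ℝ) :
    Vp * φ (ℓ / g) ≤ pathVelocity ℓ h Vm Vp φ w T z t := by
  have := M.free_le_avgVelocity (hz.platoon t)
  rwa [row_zero] at this

lemma IsPath.le_gap (hz : IsPath ℓ h Vm Vp φ w g T z) (t : ℝ) : g ≤ z (t + T) - z t := by
  have := (hz.platoon t).le_gap 0
  rwa [zero_add, row_zero, row_one] at this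

/-- Consecutive cars are never slower than their leaders, so the gaps decrease in time. -/
lemma IsModel.antitone_gap (M : IsModel ℓ h Vm Vp φ w g) (hz : IsPath ℓ h Vm Vp φ w g T z) :
    Antitone fun t => z (t + T) - z t := by
  have hd : ∀ t, HasDerivAt (fun t => z (t + T) - z t)
      (pathVelocity ℓ h Vm Vp φ w T z (t + T) - pathVelocity ℓ h Vm Vp φ w T z t) t := fun t =>
    ((hz.hasDerivAt (t + T)).comp_add_const t T).fun_sub (hz.hasDerivAt t)
  refine antitone_of_deriv_nonpos (fun t => (hd t).differentiableAt) fun t => ?_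
  rw [(hd t).deriv, sub_nonpos]
  have := M.avgVelocity_tail_le (hz.platoon t)
  rwa [row_tail, row_one, row_zero] at this

/-- The profile that a path `z` with inverse `τ` traces out: `P(z(t)) = ℓ / (z(t + T) - z(t))`. -/
noncomputable def pathProfile (ℓ T : ℝ) (z τ : ℝ → ℝ) (x : ℝ) : ℝ := ℓ / (z (τ x + T) - x)

lemma leader_iterate_pathProfile {τ : ℝ → ℝ} (hℓ : ℓ ≠ 0) (h1 : ∀ x, z (τ x) = x)
    (h2 : ∀ t, τ (z t) = t) (x : ℝ) :
    (fun k => (leader ℓ (pathProfile ℓ T z τ))^[k] x) = row T z (τ x) := by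
  funext k
  induction k with
  | zero => simp [row, h1]
  | succ k ih =>
    rw [Function.iterate_succ_apply', ih]
    simp only [row, leader, pathProfile]
    rw [h2, div_div_cancel₀ hℓ, add_sub_cancel]
    congr 1
    push_cast
    ring

/-- The path profile satisfies the delay integro-differential equation. -/
lemma IsModel.hasDerivAt_pathProfile (M : IsModel ℓ h Vm Vp φ w g) (hℓg : ℓ < g)
    (hz : IsPath ℓ h Vm Vp φ w g T z) {τ : ℝ → ℝ} (h1 : ∀ x, z (τ x) = x)
    (h2 : ∀ t, τ (z t) = t)
    (h3 : ∀ x, HasDerivAt τ (pathVelocity ℓ h Vm Vp φ w T z (τ x))⁻¹ x) (x : ℝ) :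
    HasDerivAt (pathProfile ℓ T z τ) (profileRHS ℓ h Vm Vp φ w (pathProfile ℓ T z τ) x) x := by
  have hℓ := M.length_pos
  have hgap : 0 < z (τ x + T) - x := by
    have := hz.le_gap (τ x)
    rw [h1] at this
    exact M.gap_pos.trans_le this
  have hlead : leader ℓ (pathProfile ℓ T z τ) x = z (τ x + T) := by
    simp only [leader, pathProfile]
    rw [div_div_cancel₀ hℓ.ne', add_sub_cancel]
  have hA : avgVelocity h Vm Vp φ w (stepDensity ℓ (pathProfile ℓ T z τ) x) x
      = pathVelocity ℓ h Vm Vp φ w T z (τ x) := by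
    rw [stepDensity_eq_carDensity _ _ hℓ.ne', leader_iterate_pathProfile hℓ.ne' h1 h2,
      pathVelocity, h1]
  have hB : avgVelocity h Vm Vp φ w (stepDensity ℓ (pathProfile ℓ T z τ) x)
      (leader ℓ (pathProfile ℓ T z τ) x) = pathVelocity ℓ h Vm Vp φ w T z (τ x + T) := by
    rw [stepDensity_eq_carDensity _ _ hℓ.ne', leader_iterate_pathProfile hℓ.ne' h1 h2, hlead,
      M.pathVelocity_tail hz]
  have hpos : 0 < pathVelocity ℓ h Vm Vp φ w T z (τ x) :=
    (M.free_pos hℓg).trans_le (M.free_le_pathVelocity hz _)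
  rw [profileRHS, hA, hB]
  have hd1 : HasDerivAt (fun y => z (τ y + T))
      (pathVelocity ℓ h Vm Vp φ w T z (τ x + T) * (pathVelocity ℓ h Vm Vp φ w T z (τ x))⁻¹) x :=
    (hz.hasDerivAt (τ x + T)).comp x ((h3 x).add_const T)
  have hd2 := (hasDerivAt_const x ℓ).fun_div (hd1.fun_sub (hasDerivAt_id' x)) hgap.ne'
  refine hd2.congr_deriv ?_
  simp only [pathProfile]
  field_simp
  ring

section Limit

variable {ρm ρp : ℝ} {τ : ℝ → ℝ}

lemma IsModel.pathVelocity_le (M : IsModel ℓ h Vm Vp φ w g)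
    (hz : IsPath ℓ h Vm Vp φ w g T z) (t : ℝ) :
    pathVelocity ℓ h Vm Vp φ w T z t ≤ Vm * φ (ℓ / (z (t + T) - z t)) := by
  have h1 := M.avgVelocity_le (hz.platoon t)
  rw [row_zero, row_one] at h1
  refine h1.trans (mul_le_mul_of_nonneg_right (speedLimit_le M.lt.le _) ?_)
  exact (M.velocity.mapsTo (M.density_mem (hz.le_gap t))).1

/-- Far to the left of the jump of the speed limit, the gap `ℓ / P(x)` is `T` times a velocity that
is at most `Vm`, at most `Vm φ(P(x))`, and at least `Vm φ(P(x + T Vm + h))`, since within the time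
`T` the car sees no farther than `x + T Vm + h`. -/
lemma IsModel.pathProfile_bounds (M : IsModel ℓ h Vm Vp φ w g) (hℓg : ℓ < g) (hT : 0 < T)
    (hz : IsPath ℓ h Vm Vp φ w g T z) (h1 : ∀ x, z (τ x) = x) (h2 : ∀ t, τ (z t) = t)
    (hmono : Monotone (pathProfile ℓ T z τ)) {x : ℝ} (hx : x + (T * Vm + h) < 0) :
    ℓ ≤ T * Vm * pathProfile ℓ T z τ x ∧
      ℓ ≤ T * Vm * (pathProfile ℓ T z τ x * φ (pathProfile ℓ T z τ x)) ∧
      T * Vm * (pathProfile ℓ T z τ x * φ (pathProfile ℓ T z τ (x + (T * Vm + h)))) ≤ ℓ := by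
  have hℓ := M.length_pos
  have hh := M.window_pos
  have hVm := M.pos.trans M.lt
  have hzc : Continuous z :=
    continuous_iff_continuousAt.2 fun t => (hz.hasDerivAt t).continuousAt
  have hzm : StrictMono z := strictMono_of_deriv_pos fun t => by
    rw [(hz.hasDerivAt t).deriv]
    exact (M.free_pos hℓg).trans_le (M.free_le_pathVelocity hz _)
  have hgapx : g ≤ z (τ x + T) - x := by simpa only [h1] using hz.le_gap (τ x)
  have hPmem : ∀ y, pathProfile ℓ T z τ y ∈ Icc (0 : ℝ) 1 := fun y =>
    M.density_mem (by simpa only [h1] using hz.le_gap (τ y))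
  obtain ⟨s, hs, hslope⟩ := exists_hasDerivAt_eq_slope z (pathVelocity ℓ h Vm Vp φ w T z)
    (by linarith : τ x < τ x + T) hzc.continuousOn fun t _ => hz.hasDerivAt t
  rw [h1, add_sub_cancel_left, eq_div_iff hT.ne'] at hslope
  -- `P(x)` times the gap at `x` is `ℓ`, and the gap is `T` times the velocity at some time `s`.
  have hkey : ℓ = T * pathProfile ℓ T z τ x * pathVelocity ℓ h Vm Vp φ w T z s := by
    have hne : z (τ x + T) - x ≠ 0 := (M.gap_pos.trans_le hgapx).ne'
    rw [mul_right_comm, mul_comm T, hslope, pathProfile]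
    field_simp
  have hup : pathVelocity ℓ h Vm Vp φ w T z s ≤ Vm * φ (pathProfile ℓ T z τ x) := by
    refine (M.pathVelocity_le hz s).trans (mul_le_mul_of_nonneg_left ?_ hVm.le)
    have h3 : pathProfile ℓ T z τ (z s) = ℓ / (z (s + T) - z s) := by rw [pathProfile, h2]
    rw [← h3]
    refine M.velocity.strictAntiOn.antitoneOn (hPmem x) (hPmem _) (hmono ?_)
    rw [← h1 x]
    exact hzm.monotone hs.1.le
  have hφ1 := (M.velocity.mapsTo (hPmem x)).2
  have hup' : pathVelocity ℓ h Vm Vp φ w T z s ≤ Vm :=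
    hup.trans (by nlinarith)
  have hP0 := (hPmem x).1
  have hzs : z s + h ≤ x + (T * Vm + h) := by
    have h3 : z s ≤ z (τ x + T) := hzm.monotone hs.2.le
    nlinarith
  have hlow : Vm * φ (pathProfile ℓ T z τ (x + (T * Vm + h)))
      ≤ pathVelocity ℓ h Vm Vp φ w T z s := by
    have h3 := M.le_avgVelocity (hz.platoon s)
    rw [row_zero, speedLimit, if_pos (hzs.trans_lt hx)] at h3
    refine le_trans (mul_le_mul_of_nonneg_left ?_ hVm.le) h3
    have h4 : row T z s 0 ≤ z s + h := by rw [row_zero]; linarith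
    refine M.velocity.strictAntiOn.antitoneOn
      ((hz.platoon s).carDensity_mem_Icc M.gap_pos hℓ M.length_le h4) (hPmem _) ?_
    obtain ⟨k, hk⟩ := (hz.platoon s).exists_mem_Ico M.gap_pos h4
    rw [(hz.platoon s).carDensity_eq M.gap_pos hk]
    have h5 : ℓ / (row T z s (k + 1) - row T z s k) = pathProfile ℓ T z τ (row T z s k) := by
      simp only [row, pathProfile, h2]
      congr 3
      push_cast
      ring
    rw [h5]
    exact hmono (hk.1.trans hzs)
  have hTP : 0 ≤ T * pathProfile ℓ T z τ x := mul_nonneg hT.le hP0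
  refine ⟨?_, ?_, ?_⟩
  · nlinarith [mul_le_mul_of_nonneg_left hup' hTP]
  · nlinarith [mul_le_mul_of_nonneg_left hup hTP]
  · nlinarith [mul_le_mul_of_nonneg_left hlow hTP]

end Limit

end FollowTheLeaders

namespace FollowTheLeaders

variable {φ w z τ Q : ℝ → ℝ} {ℓ h Vm Vp g T r ρm ρp : ℝ}

lemma IsModel.monotone_pathProfile (M : IsModel ℓ h Vm Vp φ w g)
    (hz : IsPath ℓ h Vm Vp φ w g T z) (h1 : ∀ x, z (τ x) = x) (hτ : Monotone τ) :
    Monotone (pathProfile ℓ T z τ) := by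
  intro x y hxy
  have h3 := M.antitone_gap hz (hτ hxy)
  have h4 := hz.le_gap (τ y)
  simp only [h1] at h3 h4
  exact div_le_div_of_nonneg_left M.length_pos.le (M.gap_pos.trans_le h4) h3

/-- The limit at `-∞` of the profile is identified by its flux, which equals `ℓ / T`. -/
lemma IsModel.tendsto_pathProfile_atBot (M : IsModel ℓ h Vm Vp φ w g) (hℓg : ℓ < g) (hT : 0 < T)
    (hz : IsPath ℓ h Vm Vp φ w g T z) (h1 : ∀ x, z (τ x) = x) (h2 : ∀ t, τ (z t) = t)
    (hτ : Monotone τ) (hr : IsStagnation φ r) (hρm : ρm ∈ Icc 0 r) (hgr : ℓ / g ≤ r)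
    (hflux : T * Vm * flux φ ρm = ℓ) :
    Tendsto (pathProfile ℓ T z τ) atBot (𝓝 ρm) := by
  have hmono := M.monotone_pathProfile hz h1 hτ
  have hTV : 0 < T * Vm := mul_pos hT (M.pos.trans M.lt)
  have hgap : ∀ x, g ≤ z (τ x + T) - x := fun x => by simpa only [h1] using hz.le_gap (τ x)
  have hPmem : ∀ x, pathProfile ℓ T z τ x ∈ Icc (0 : ℝ) 1 := fun x => M.density_mem (hgap x)
  have hPle : ∀ x, pathProfile ℓ T z τ x ≤ ℓ / g := fun x =>
    div_le_div_of_nonneg_left M.length_pos.le M.gap_pos (hgap x)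
  obtain ⟨p, hp⟩ : ∃ p, Tendsto (pathProfile ℓ T z τ) atBot (𝓝 p) :=
    ⟨_, tendsto_atBot_ciInf hmono ⟨0, by rintro _ ⟨x, rfl⟩; exact (hPmem x).1⟩⟩
  have hev : ∀ᶠ x in atBot, x + (T * Vm + h) < 0 := by
    filter_upwards [eventually_lt_atBot (-(T * Vm + h))] with x hx
    linarith
  have hbd := fun x hx => M.pathProfile_bounds hℓg hT hz h1 h2 hmono (x := x) hx
  have hp0 : 0 < p := by
    have h3 : ℓ ≤ T * Vm * p :=
      ge_of_tendsto (hp.const_mul (T * Vm)) (hev.mono fun x hx => (hbd x hx).1)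
    by_contra hneg
    have := M.length_pos
    nlinarith
  have hpg : p ≤ ℓ / g := le_of_tendsto hp (Eventually.of_forall hPle)
  have hp1 : p < 1 := hpg.trans_lt ((div_lt_one M.gap_pos).2 hℓg)
  have hφp : ContinuousAt φ p :=
    (M.velocity.contDiffOn.continuousOn p ⟨hp0.le, hp1.le⟩).continuousAt (Icc_mem_nhds hp0 hp1)
  have hshift : Tendsto (fun x => pathProfile ℓ T z τ (x + (T * Vm + h))) atBot (𝓝 p) :=
    hp.comp (tendsto_atBot_add_const_right _ _ tendsto_id)
  have hle : ℓ ≤ T * Vm * (p * φ p) :=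
    ge_of_tendsto ((hp.mul (hφp.tendsto.comp hp)).const_mul (T * Vm))
      (hev.mono fun x hx => (hbd x hx).2.1)
  have hge : T * Vm * (p * φ p) ≤ ℓ :=
    le_of_tendsto ((hp.mul (hφp.tendsto.comp hshift)).const_mul (T * Vm))
      (hev.mono fun x hx => (hbd x hx).2.2)
  have hfl : flux φ p = flux φ ρm := by
    refine mul_left_cancel₀ hTV.ne' ?_
    rw [hflux]
    exact le_antisymm hge hle
  rwa [← (hr.strictMonoOn_flux M.velocity).injOn ⟨hp0.le, hpg.trans hgr⟩ hρm hfl]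

/-- A path of the cars traces out a monotone profile. -/
lemma IsModel.exists_profile_of_isPath (M : IsModel ℓ h Vm Vp φ w g) (hℓg : ℓ < g) (hT : 0 < T)
    (hz : IsPath ℓ h Vm Vp φ w g T z) (hvT : Vp * φ (ℓ / g) * T = g) (hr : IsStagnation φ r)
    (hρm : ρm ∈ Icc 0 r) (hgr : ℓ / g ≤ r) (hflux : T * Vm * flux φ ρm = ℓ) :
    ∃ P : ℝ → ℝ, IsProfile ℓ h Vm Vp φ w ρm (ℓ / g) P ∧ Monotone P ∧
      (∀ x, 0 ≤ x → P x = ℓ / g) ∧ ∀ t, P (z t) = ℓ / (z (t + T) - z t) := by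
  obtain ⟨τ, h1, h2, hτ, h3⟩ := exists_inverse_of_le_deriv (M.free_pos hℓg) hz.hasDerivAt
    (M.free_le_pathVelocity hz)
  have hgap : ∀ x, g ≤ z (τ x + T) - x := fun x => by simpa only [h1] using hz.le_gap (τ x)
  have hvel : ∀ t, pathVelocity ℓ h Vm Vp φ w T z t ≠ 0 := fun t =>
    ((M.free_pos hℓg).trans_le (M.free_le_pathVelocity hz t)).ne'
  have hder := M.hasDerivAt_pathProfile hℓg hz h1 h2 h3
  have hright : ∀ x, 0 ≤ x → pathProfile ℓ T z τ x = ℓ / g := by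
    intro x hx
    have h4 : 0 ≤ τ x := by
      have h5 : τ 0 = 0 := by
        have := h2 0
        rwa [hz.eq_of_nonneg 0 le_rfl, mul_zero] at this
      exact h5 ▸ hτ.monotone hx
    have h5 : z (τ x + T) - x = g := by
      have h6 := hz.eq_of_nonneg (τ x) h4
      rw [h1] at h6
      rw [hz.eq_of_nonneg _ (add_nonneg h4 hT.le), mul_add, hvT, ← h6, add_sub_cancel_left]
    rw [pathProfile, h5]
  refine ⟨pathProfile ℓ T z τ, ⟨?_, fun x => ⟨?_, ?_⟩, hder, ?_, ?_⟩,
    M.monotone_pathProfile hz h1 hτ.monotone, hright, fun t => by rw [pathProfile, h2]⟩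
  · have hzc : Continuous z :=
      continuous_iff_continuousAt.2 fun t => (hz.hasDerivAt t).continuousAt
    have hzC : ContDiff ℝ 1 z := by
      refine contDiff_one_iff_deriv.2 ⟨fun t => (hz.hasDerivAt t).differentiableAt, ?_⟩
      exact hz.continuous_velocity.congr fun t => (hz.hasDerivAt t).deriv.symm
    have hτc : Continuous τ := continuous_iff_continuousAt.2 fun x => (h3 x).continuousAt
    have hτC : ContDiff ℝ 1 τ := by
      refine contDiff_one_iff_deriv.2 ⟨fun x => (h3 x).differentiableAt, ?_⟩
      exact ((hz.continuous_velocity.comp hτc).inv₀ fun x => hvel _).congr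
        fun x => (h3 x).deriv.symm
    exact contDiff_const.div ((hzC.comp (hτC.add contDiff_const)).sub contDiff_id) fun x =>
      (M.gap_pos.trans_le (hgap x)).ne'
  · exact div_pos M.length_pos (M.gap_pos.trans_le (hgap x))
  · exact (div_lt_one (M.gap_pos.trans_le (hgap x))).2 (hℓg.trans_le (hgap x))
  · exact M.tendsto_pathProfile_atBot hℓg hT hz h1 h2 hτ.monotone hr hρm hgr hflux
  · refine tendsto_const_nhds.congr' ?_
    filter_upwards [eventually_ge_atTop 0] with x hx using (hright x hx).symm

/-! ### Monotone profiles come from the path -/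

/-- The velocity of the car at `x` in the profile `Q`. -/
noncomputable def profileVelocity (ℓ h Vm Vp : ℝ) (φ w Q : ℝ → ℝ) (x : ℝ) : ℝ :=
  avgVelocity h Vm Vp φ w (stepDensity ℓ Q x) x

namespace IsProfile

lemma continuous_leader (hQ : IsProfile ℓ h Vm Vp φ w ρm ρp Q) : Continuous (leader ℓ Q) :=
  continuous_id.add (continuous_const.div hQ.contDiff.continuous fun x => (hQ.mem_Ioo x).1.ne')

lemma isPlatoon (hQ : IsProfile ℓ h Vm Vp φ w ρm ρp Q) (hmono : Monotone Q) (hℓ : 0 < ℓ)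
    (x : ℝ) : IsPlatoon (ℓ / ρp) fun k => (leader ℓ Q)^[k] x := by
  have hgap : ∀ k, (leader ℓ Q)^[k + 1] x - (leader ℓ Q)^[k] x = ℓ / Q ((leader ℓ Q)^[k] x) :=
    fun k => by rw [Function.iterate_succ_apply', leader, add_sub_cancel_left]
  have hlt : ∀ k, (leader ℓ Q)^[k] x ≤ (leader ℓ Q)^[k + 1] x := fun k => by
    have := div_pos hℓ (hQ.mem_Ioo ((leader ℓ Q)^[k] x)).1
    rw [← hgap] at this
    linarith
  constructor
  · intro k
    rw [hgap]
    exact div_le_div_of_nonneg_left hℓ.le (hQ.mem_Ioo _).1 (hmono.ge_of_tendsto hQ.tendsto_atTop _)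
  · intro k
    refine (hgap (k + 1)).trans_le (le_trans ?_ (hgap k).ge)
    exact div_le_div_of_nonneg_left hℓ.le (hQ.mem_Ioo _).1 (hmono (hlt k))

lemma velocity_eq_spreadVelocity (hQ : IsProfile ℓ h Vm Vp φ w ρm ρp Q) (hmono : Monotone Q)
    (M : IsModel ℓ h Vm Vp φ w (ℓ / ρp)) {N : ℕ} (hN : h ≤ N * (ℓ / ρp)) (x : ℝ) :
    profileVelocity ℓ h Vm Vp φ w Q x
      = spreadVelocity ℓ Vm Vp φ w (ℓ / ρp) N fun k => (leader ℓ Q)^[k] x := by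
  rw [M.spreadVelocity_eq (hQ.isPlatoon hmono M.length_pos x) hN,
    ← stepDensity_eq_carDensity _ _ M.length_pos.ne']
  rfl

lemma continuous_velocity (hQ : IsProfile ℓ h Vm Vp φ w ρm ρp Q) (hmono : Monotone Q)
    (M : IsModel ℓ h Vm Vp φ w (ℓ / ρp)) : Continuous (profileVelocity ℓ h Vm Vp φ w Q) := by
  obtain ⟨N, hN⟩ := M.exists_le_mul
  have h1 := (M.supRegular_spreadVelocity N).1.comp
    (continuous_pi fun k => hQ.continuous_leader.iterate k)
  exact h1.congr fun x => (hQ.velocity_eq_spreadVelocity hmono M hN x).symm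

lemma free_le_velocity (hQ : IsProfile ℓ h Vm Vp φ w ρm ρp Q) (hmono : Monotone Q)
    (M : IsModel ℓ h Vm Vp φ w (ℓ / ρp)) (x : ℝ) :
    Vp * φ ρp ≤ profileVelocity ℓ h Vm Vp φ w Q x := by
  have := M.free_le_avgVelocity (hQ.isPlatoon hmono M.length_pos x)
  rw [← stepDensity_eq_carDensity _ _ M.length_pos.ne', div_div_cancel₀ M.length_pos.ne'] at this
  exact this

lemma velocity_le (hQ : IsProfile ℓ h Vm Vp φ w ρm ρp Q) (hmono : Monotone Q)
    (M : IsModel ℓ h Vm Vp φ w (ℓ / ρp)) (x : ℝ) :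
    profileVelocity ℓ h Vm Vp φ w Q x ≤ speedLimit Vm Vp x * φ (Q x) := by
  have := M.avgVelocity_le (hQ.isPlatoon hmono M.length_pos x)
  rw [← stepDensity_eq_carDensity _ _ M.length_pos.ne'] at this
  simpa [profileVelocity, leader, div_div_cancel₀ M.length_pos.ne'] using this

/-- The differential equation in terms of the leader map: `L'(x) = A(L(x)) / A(x)` for the velocity
`A`. Hence the time `∫ 1/A` that the car at `x` needs to reach its leader's position does not depend
on `x`. -/
lemma hasDerivAt_leader (hQ : IsProfile ℓ h Vm Vp φ w ρm ρp Q) (hmono : Monotone Q)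
    (M : IsModel ℓ h Vm Vp φ w (ℓ / ρp)) (hρp : 0 < Vp * φ ρp) (x : ℝ) :
    HasDerivAt (leader ℓ Q) (profileVelocity ℓ h Vm Vp φ w Q (leader ℓ Q x) /
      profileVelocity ℓ h Vm Vp φ w Q x) x := by
  have hQ0 := (hQ.mem_Ioo x).1.ne'
  have hℓ := M.length_pos.ne'
  have hA := (hρp.trans_le (hQ.free_le_velocity hmono M x)).ne'
  have htail : avgVelocity h Vm Vp φ w (stepDensity ℓ Q x) (leader ℓ Q x)
      = profileVelocity ℓ h Vm Vp φ w Q (leader ℓ Q x) := by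
    have := M.avgVelocity_tail (hQ.isPlatoon hmono M.length_pos x)
    rw [← stepDensity_eq_carDensity _ _ hℓ] at this
    rw [profileVelocity, stepDensity_eq_carDensity _ _ hℓ (leader ℓ Q x)]
    exact this.symm
  have h1 := (hasDerivAt_id' x).fun_add ((hasDerivAt_const x ℓ).fun_div (hQ.equation x) hQ0)
  refine h1.congr_deriv ?_
  rw [profileRHS, htail]
  change 1 + (0 * Q x - ℓ * (Q x ^ 2 / (ℓ * profileVelocity ℓ h Vm Vp φ w Q x) *
    (profileVelocity ℓ h Vm Vp φ w Q x - _))) / Q x ^ 2 = _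
  field_simp
  ring

/-- A monotone profile comes from a solution `z` of the modified equation of motion. -/
lemma exists_isAdvanceSolution (hQ : IsProfile ℓ h Vm Vp φ w ρm ρp Q) (hmono : Monotone Q)
    (M : IsModel ℓ h Vm Vp φ w (ℓ / ρp)) (hρ0 : 0 < ρp) (hρ1 : ρp < 1) (hr : IsStagnation φ r)
    (hρr : ρp ≤ r) {N : ℕ} (hN : h ≤ N * (ℓ / ρp)) (hT : T = ℓ / (Vp * flux φ ρp)) :
    ∃ z : ℝ → ℝ, IsAdvanceSolution (spreadVelocity ℓ Vm Vp φ w (ℓ / ρp) N) T (Vp * φ ρp) z ∧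
      Function.Surjective z ∧ ∀ t, Q (z t) = ℓ / (z (t + T) - z t) := by
  have hℓ := M.length_pos
  have hφρ := M.velocity.pos hρ0.le hρ1
  have hv : 0 < Vp * φ ρp := mul_pos M.pos hφρ
  have hVm := M.pos.trans M.lt
  set A := profileVelocity ℓ h Vm Vp φ w Q with hAdef
  have hQle : ∀ x, Q x ≤ ρp := fun x => hmono.ge_of_tendsto hQ.tendsto_atTop x
  have hQmem : ∀ x, Q x ∈ Icc (0 : ℝ) 1 := fun x => Ioo_subset_Icc_self (hQ.mem_Ioo x)
  have hAc : Continuous A := hQ.continuous_velocity hmono M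
  have hAv : ∀ x, Vp * φ ρp ≤ A x := hQ.free_le_velocity hmono M
  have hA0 : ∀ x, 0 < A x := fun x => hv.trans_le (hAv x)
  have hAVm : ∀ x, A x ≤ Vm := fun x => by
    have h1 := hQ.velocity_le hmono M x
    have h2 := M.velocity.mapsTo (hQmem x)
    have h3 := speedLimit_le M.lt.le x
    refine h1.trans ?_
    nlinarith [h2.1, h2.2]
  have hAi : Continuous fun x => (A x)⁻¹ := hAc.inv₀ fun x => (hA0 x).ne'
  obtain ⟨τ, hτ0, hτ⟩ : ∃ τ : ℝ → ℝ, τ 0 = 0 ∧ ∀ x, HasDerivAt τ (A x)⁻¹ x :=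
    ⟨fun x => ∫ y in (0 : ℝ)..x, (A y)⁻¹, by simp,
      fun x => (hAi.integral_hasStrictDerivAt 0 x).hasDerivAt⟩
  obtain ⟨z, h1, h2, hzm, h3⟩ := exists_inverse_of_le_deriv (inv_pos.2 hVm) hτ
    fun x => inv_anti₀ (hA0 x) (hAVm x)
  have h3' : ∀ t, HasDerivAt z (A (z t)) t := fun t => by simpa using h3 t
  -- The travel time to the leader's position is a constant `C`.
  obtain ⟨C, hC⟩ : ∃ C, ∀ x, τ (leader ℓ Q x) - τ x = C := by
    have hd : ∀ x, HasDerivAt (fun x => τ (leader ℓ Q x) - τ x) 0 x := fun x => by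
      have h4 := ((hτ (leader ℓ Q x)).comp x (hQ.hasDerivAt_leader hmono M hv x)).fun_sub (hτ x)
      refine h4.congr_deriv ?_
      change (A (leader ℓ Q x))⁻¹ * (A (leader ℓ Q x) / A x) - (A x)⁻¹ = 0
      have := (hA0 x).ne'
      have := (hA0 (leader ℓ Q x)).ne'
      field_simp
      simp
    exact ⟨_, fun x => is_const_of_deriv_eq_zero (fun x => (hd x).differentiableAt)
      (fun x => (hd x).deriv) x 0⟩
  have hmean : ∀ x, ∃ s, x < s ∧ ℓ = C * Q x * A s := by
    intro x
    have hQ0 := (hQ.mem_Ioo x).1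
    have hlt : x < leader ℓ Q x := by
      simp only [leader, lt_add_iff_pos_right]
      exact div_pos hℓ hQ0
    obtain ⟨s, hs, hslope⟩ := exists_hasDerivAt_eq_slope τ (fun x => (A x)⁻¹) hlt
      (fun y _ => (hτ y).continuousAt.continuousWithinAt) fun y _ => hτ y
    refine ⟨s, hs.1, ?_⟩
    rw [hC, leader, add_sub_cancel_left] at hslope
    have := (hA0 s).ne'
    field_simp at hslope
    linarith
  have hC0 : 0 < C := by
    obtain ⟨s, -, hs⟩ := hmean 0
    by_contra hneg
    have := mul_pos (hQ.mem_Ioo 0).1 (hA0 s)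
    nlinarith
  have hCle : C * ρp * (Vp * φ ρp) ≤ ℓ := by
    refine le_of_tendsto ((hQ.tendsto_atTop.const_mul C).mul_const (Vp * φ ρp))
      (Eventually.of_forall fun x => ?_)
    obtain ⟨s, -, hs⟩ := hmean x
    exact (mul_le_mul_of_nonneg_left (hAv s) (mul_nonneg hC0.le (hQmem x).1)).trans hs.ge
  have hCge : ∀ x, 0 ≤ x → ℓ ≤ C * Vp * flux φ (Q x) := by
    intro x hx
    obtain ⟨s, hxs, hs⟩ := hmean x
    have h4 : A s ≤ Vp * φ (Q x) := by
      have h5 := hQ.velocity_le hmono M s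
      rw [speedLimit, if_neg (not_lt.2 (hx.trans hxs.le))] at h5
      exact h5.trans (mul_le_mul_of_nonneg_left (M.velocity.strictAntiOn.antitoneOn (hQmem x)
        (hQmem s) (hmono hxs.le)) M.pos.le)
    have h5 := mul_le_mul_of_nonneg_left h4 (mul_nonneg hC0.le (hQmem x).1)
    rw [← hs] at h5
    unfold flux
    linarith
  -- Right of the jump, the flux of the profile is at least that of its limit.
  have hQright : ∀ x, 0 ≤ x → Q x = ρp := by
    intro x hx
    refine le_antisymm (hQle x) ?_
    refine ((hr.strictMonoOn_flux M.velocity).le_iff_le ⟨hρ0.le, hρr⟩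
      ⟨(hQmem x).1, (hQle x).trans hρr⟩).1 ?_
    have h4 := hCge x hx
    have h5 : C * Vp * flux φ ρp ≤ C * Vp * flux φ (Q x) := by
      refine le_trans (le_of_eq ?_) (hCle.trans h4)
      unfold flux
      ring
    exact le_of_mul_le_mul_left h5 (mul_pos hC0 M.pos)
  have hCT : C = T := by
    have h4 := hCge 0 le_rfl
    rw [hQright 0 le_rfl] at h4
    unfold flux at hT h4
    have hVp := M.pos
    rw [hT, eq_div_iff (by positivity)]
    linarith
  have hAright : ∀ x, 0 ≤ x → A x = Vp * φ ρp := by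
    intro x hx
    refine le_antisymm ((hQ.velocity_le hmono M x).trans_eq ?_) (hAv x)
    rw [speedLimit, if_neg (not_lt.2 hx), hQright x hx]
  have hz0 : z 0 = 0 := by simpa only [hτ0] using h2 0
  have hzright : ∀ t, 0 ≤ t → z t = Vp * φ ρp * t := by
    intro t ht
    have h4 : ∫ s in (0 : ℝ)..t, A (z s) = z t - z 0 :=
      intervalIntegral.integral_eq_sub_of_hasDerivAt (fun s _ => h3' s)
        ((hAc.comp (continuous_iff_continuousAt.2
          fun s => (h3' s).continuousAt)).intervalIntegrable _ _)
    rw [hz0, sub_zero] at h4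
    rw [← h4]
    have h5 : ∫ s in (0 : ℝ)..t, A (z s) = ∫ s in (0 : ℝ)..t, Vp * φ ρp := by
      refine intervalIntegral.integral_congr fun s hs => ?_
      rw [uIcc_of_le ht] at hs
      exact hAright _ (hz0 ▸ hzm.monotone hs.1)
    rw [h5, intervalIntegral.integral_const, sub_zero, smul_eq_mul, mul_comm]
  have hzL : ∀ t, z (t + T) = leader ℓ Q (z t) := by
    intro t
    rw [← h2 (leader ℓ Q (z t)), ← hCT, ← hC (z t), h1, add_sub_cancel]
  have hrow : ∀ t, (fun k : ℕ => z (t + k * T)) = fun k => (leader ℓ Q)^[k] (z t) := by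
    intro t
    funext k
    induction k with
    | zero => simp
    | succ k ih =>
      rw [Function.iterate_succ_apply', ← ih, ← hzL]
      congr 1
      push_cast
      ring
  have hzc : Continuous z := continuous_iff_continuousAt.2 fun t => (h3' t).continuousAt
  refine ⟨z, ⟨hzc, hzright, fun t _ => ?_⟩, fun x => ⟨τ x, h2 x⟩, fun t => ?_⟩
  · have h4 : ∫ s in (0 : ℝ)..t, A (z s) = z t - z 0 :=
      intervalIntegral.integral_eq_sub_of_hasDerivAt (fun s _ => h3' s)
        ((hAc.comp hzc).intervalIntegrable _ _)
    rw [hz0, sub_zero] at h4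
    rw [← h4]
    refine intervalIntegral.integral_congr fun s _ => ?_
    simp only [hrow]
    exact hQ.velocity_eq_spreadVelocity hmono M hN _
  · rw [hzL, leader, add_sub_cancel_left, div_div_cancel₀ hℓ.ne']

end IsProfile

end FollowTheLeaders

theorem mainTheorem1 (ℓ h Vm Vp : ℝ) (φ w : ℝ → ℝ) (ρm ρp ρhat : ℝ)
    (hℓ : 0 < ℓ) (hh : 0 < h)
    (hw : FollowTheLeaders.IsWeight h w) (hφ : FollowTheLeaders.IsVelocity φ)
    (hVp : 0 < Vp) (hV : Vp < Vm)
    (hρhat : FollowTheLeaders.IsStagnation φ ρhat)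
    (hρm : 0 < ρm) (hρ : ρm < ρp) (hρp : ρp ≤ ρhat)
    (hflux : Vm * FollowTheLeaders.flux φ ρm = Vp * FollowTheLeaders.flux φ ρp) :
    ∃ P : ℝ → ℝ,
      FollowTheLeaders.IsProfile ℓ h Vm Vp φ w ρm ρp P ∧
      Monotone P ∧
      (∀ x : ℝ, 0 ≤ x → P x = ρp) ∧
      ∀ Q : ℝ → ℝ, FollowTheLeaders.IsProfile ℓ h Vm Vp φ w ρm ρp Q →
        (Monotone Q ∨ Antitone Q) → Q = P := by
  open FollowTheLeaders in
  have hρ0 : 0 < ρp := hρm.trans hρ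
  have hρ1 : ρp < 1 := hρp.trans_lt (hρhat.lt_one hφ)
  have hφρ : 0 < φ ρp := hφ.pos hρ0.le hρ1
  have hℓg : ℓ < ℓ / ρp := (lt_div_iff₀ hρ0).2 (by nlinarith)
  have hg : ℓ / (ℓ / ρp) = ρp := div_div_cancel₀ hℓ.ne'
  have M : IsModel ℓ h Vm Vp φ w (ℓ / ρp) := ⟨hℓ, hh, hℓg.le, hVp, hV, hφ, hw⟩
  have hf : 0 < flux φ ρp := mul_pos hρ0 hφρ
  obtain ⟨T, hT⟩ : ∃ T, T = ℓ / (Vp * flux φ ρp) := ⟨_, rfl⟩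
  have hT0 : 0 < T := hT ▸ by positivity
  have hT' : T = ℓ / ρp / (Vp * φ (ℓ / (ℓ / ρp))) := by
    rw [hT, hg, flux, div_div]
    ring_nf
  obtain ⟨N, hN⟩ := M.exists_le_mul
  obtain ⟨hcont, K, hK0, hK⟩ := M.supRegular_spreadVelocity N
  obtain ⟨z, hz, huniq⟩ := existsUnique_isAdvanceSolution hcont (M.abs_spreadVelocity_le N) hK0 hK
    hT0.le (Vp * φ ρp)
  have hpath : IsPath ℓ h Vm Vp φ w (ℓ / ρp) T z :=
    M.isPath_of_isAdvanceSolution hℓg hN hT' (by rwa [hg])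
  obtain ⟨P, hP, hPmono, hPright, hPz⟩ := M.exists_profile_of_isPath (ρm := ρm) hℓg hT0 hpath
    (by rw [hT', mul_div_cancel₀ _ (by rw [hg]; positivity)]) hρhat
    ⟨hρm.le, hρ.le.trans hρp⟩ (by rwa [hg])
    (by rw [mul_assoc, hflux, hT, div_mul_cancel₀ _ (by positivity)])
  rw [hg] at hP hPright
  refine ⟨P, hP, hPmono, hPright, fun Q hQ hQmono => ?_⟩
  have hQmono : Monotone Q := by
    refine hQmono.resolve_right fun hanti => ?_
    exact not_le.2 hρ ((hanti.le_of_tendsto hQ.tendsto_atTop 0).trans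
      (hanti.ge_of_tendsto hQ.tendsto_atBot 0))
  obtain ⟨z', hz', hsurj, hQz⟩ := hQ.exists_isAdvanceSolution hQmono M hρ0 hρ1 hρhat hρp hN hT
  obtain rfl := huniq z' hz'
  funext x
  obtain ⟨t, rfl⟩ := hsurj x
  rw [hQz, hPz]
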